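/- Let $d \ge 3$ and let $\mathbb{T}_d$ be the $d$-regular tree, with edge set $E$ and automorphism group $\mathrm{Aut}(\mathbb{T}_d)$. Let $D$ be the set of ordered pairs $(u,v)$ of adjacent vertices. Let $\mathbf{X} = (X(e))_{e \in E}$ be a family of independent random variables, each uniformly distributed on $[0,1]$. Let $\mathrm{Aut}(\mathbb{T}_d)$ act by $(\gamma\cdot\omega)(e) = \omega(\gamma^{-1}e)$ on $[0,1]^{E}$ and by $(\gamma\cdot o)(u,v) = o(\gamma^{-1}u,\gamma^{-1}v)$ on $\{0,1\}^{D}$. A function $o \in \{0,1\}^{D}$ is called an orientation of the edges if $o(v,u) = 1 - o(u,v)$ for all $(u,v) \in D$; the edge $\{u,v\}$ is then oriented from $u$ to $v$ when $o(u,v)=1$. A vertex is a source if all edges incident to it are oriented away from it, and a sink if all edges incident to it are oriented towards it. Then there is an FIID (factor of iid) orientation of the edges of $\mathbb{T}_d$ with no sources and no sinks. That is, there is a map $F : [0,1]^{E} \to \{0,1\}^{D}$, measurable with respect to the product $\sigma$-algebras, such that $F(\gamma\cdot\omega) = \gamma\cdot F(\omega)$ for all $\gamma \in \mathrm{Aut}(\mathbb{T}_d)$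 and all $\omega \in [0,1]^{E}$, and such that, almost surely, $F(\mathbf{X})$ is an orientation of the edges that has no sources and no sinks. -/

import Mathlib

open MeasureTheory

/-- The law of a random labelling of the edges of `G`: independent labels, one for each edge,
all uniformly distributed on `[0, 1]`. -/
noncomputable def edgeLabelLaw {V : Type*} (G : SimpleGraph V) :
    Measure (G.edgeSet → unitInterval) :=
  Measure.infinitePi fun _ => (volume : Measure unitInterval)

/-- The action of an automorphism on edge labellings: `(γ · ω)(e) = ω(γ⁻¹ e)`. -/
def actLabelling {V : Type*} {G : SimpleGraph V} (γ : G ≃g G)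
    (ω : G.edgeSet → unitInterval) : G.edgeSet → unitInterval :=
  fun e => ω (γ.symm.mapEdgeSet e)

/-- The action of an automorphism on direction markings: `(γ · o)(u, v) = o(γ⁻¹ u, γ⁻¹ v)`. -/
def actMarking {V : Type*} {G : SimpleGraph V} (γ : G ≃g G)
    (o : G.Dart → Bool) : G.Dart → Bool :=
  fun a => o (γ.symm.toHom.mapDart a)

/-- A marking `o` of the ordered pairs of adjacent vertices is an orientation of the edges if it
marks exactly one of the two directions of each edge; `o (u, v) = true` means that the edge
`{u, v}` is oriented from `u` to `v`. -/
def IsEdgeOrientation {V : Type*} {G : SimpleGraph V} (o : G.Dart → Bool) : Prop :=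
  ∀ a : G.Dart, o a.symm = !(o a)

/-- All edges incident to `v` are oriented away from `v`. -/
def IsSource {V : Type*} {G : SimpleGraph V} (o : G.Dart → Bool) (v : V) : Prop :=
  ∀ a : G.Dart, a.fst = v → o a = true

/-- All edges incident to `v` are oriented towards `v`. -/
def IsSink {V : Type*} {G : SimpleGraph V} (o : G.Dart → Bool) (v : V) : Prop :=
  ∀ a : G.Dart, a.snd = v → o a = true

/-- `F` is the factor map of an FIID orientation of the edges of `G`: it is measurable for the
product σ-algebras, it commutes with every automorphism of `G` at every labelling, and its value
at a random labelling is almost surely an orientation. (An equivariant map cannot be an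
orientation at every labelling as soon as some automorphism swaps the endpoints of an edge:
consider a constant labelling.) -/
structure IsFIIDOrientation {V : Type*} (G : SimpleGraph V)
    (F : (G.edgeSet → unitInterval) → (G.Dart → Bool)) : Prop where
  measurable : Measurable F
  equivariant : ∀ (γ : G ≃g G) (ω : G.edgeSet → unitInterval),
    F (actLabelling γ ω) = actMarking γ (F ω)
  ae_orientation : ∀ᵐ ω ∂(edgeLabelLaw G), IsEdgeOrientation (F ω)

/-! ### Distances and geodesics in trees -/

namespace SimpleGraph

variable {V : Type*} {G : SimpleGraph V}

/-! Orient each edge towards the endpoint with the larger vertex label and remove sinks by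
augmenting paths. A geodesic ending at a sink `v` is augmenting if it points towards `v`, starts at
a vertex of out-degree at least two, and all its inner vertices have out-degree one. Reversing it
removes the sink at `v` and creates neither a sink nor a source. The same holds for many geodesics
at once if no two share a start or an end (`IsAugmentingMatching.not_sink`,
`IsAugmentingMatching.not_source`).

At stage `n` each sink with an augmenting geodesic of length at most `n` requests one, and each
requested start serves one sink. A start is requested by at most `d` sinks, so by mass transport at
least a fraction `1 / d` of these sinks disappears. If a sink has no such geodesic, its whole
`n`-ball flows into it; spheres of radius `n` have at least `2 ^ n` vertices and a vertex flows into
at most one sink, so such sinks have density at most `2 ^ (-n)`. Hence the sink density decays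
geometrically (`IsTree.measureReal_sink_sinkRemoval_le`).

A vertex lies on a geodesic reversed at stage `n` with probability at most `n + 1` times the sink
density. This is summable, so by Borel–Cantelli each edge is almost surely reversed finitely often,
and the limit is a factor orientation without sinks or new sources
(`IsTree.exists_factor_sinkless`). Applying this again to the opposite orientation removes the
sources.

Mass transport holds term by term: an automorphism exchanging two given vertices exists
(`IsTree.exists_iso_swap`) and preserves the law of the labels. -/

theorem Connected.exists_adj_dist_add_one (h : G.Connected) {x y : V} (hne : x ≠ y) :
    ∃ z, G.Adj y z ∧ G.dist x z + 1 = G.dist x y := by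
  obtain ⟨p, hp⟩ := h.exists_walk_length_eq_dist y x
  cases p with
  | nil => exact absurd rfl hne
  | @cons _ z _ hadj q =>
    refine ⟨z, hadj, ?_⟩
    have h1 : G.dist z x ≤ q.length := dist_le q
    have h2 : G.dist y x ≤ G.dist y z + G.dist z x := h.dist_triangle
    rw [dist_eq_one_iff_adj.2 hadj] at h2
    rw [Walk.length_cons] at hp
    rw [dist_comm, dist_comm (u := x) (v := y)]
    omega

/-- Either step, followed by a shortest walk to `x`, is a path, and paths in a tree are unique. -/
theorem IsTree.eq_of_adj_of_dist_add_one (hG : G.IsTree) {x y z z' : V} (hz : G.Adj y z)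
    (hz' : G.Adj y z') (h : G.dist x z + 1 = G.dist x y) (h' : G.dist x z' + 1 = G.dist x y) :
    z = z' := by
  have key : ∀ u, G.Adj y u → G.dist x u + 1 = G.dist x y →
      ∃ p : G.Walk y x, p.IsPath ∧ p.snd = u := by
    intro u hu hd
    obtain ⟨q, hq⟩ := hG.1.exists_walk_length_eq_dist u x
    refine ⟨Walk.cons hu q, Walk.isPath_of_length_eq_dist _ ?_, by simp⟩
    rw [Walk.length_cons, hq, dist_comm, hd, dist_comm]
  obtain ⟨p, hp, rfl⟩ := key z hz h
  obtain ⟨q, hq, rfl⟩ := key z' hz' h'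
  rw [(hG.existsUnique_path y x).unique hp hq]

theorem IsTree.dist_of_adj (hG : G.IsTree) (x : V) {y z : V} (h : G.Adj y z) :
    G.dist x z + 1 = G.dist x y ∨ G.dist x z = G.dist x y + 1 := by
  rcases hG.dist_eq_dist_add_one_of_adj x h with h | h <;> omega

/-- If `x ≠ y` lies on the geodesic from `y` to `v`, so does the first step from `y` towards `v`,
and it comes before `x`. -/
theorem IsTree.dist_step_of_between (hG : G.IsTree) {y z v x : V} (hyz : G.Adj y z)
    (hz : G.dist v z + 1 = G.dist v y) (hxy : x ≠ y)
    (hx : G.dist y x + G.dist x v = G.dist y v) :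
    G.dist z x + 1 = G.dist y x := by
  obtain ⟨z', hz', hd⟩ := hG.1.exists_adj_dist_add_one hxy
  have h1 : G.dist v z' ≤ G.dist v x + G.dist x z' := hG.1.dist_triangle
  have h2 := hG.dist_of_adj v hz'
  have e1 := G.dist_comm (u := v) (v := x)
  have e2 := G.dist_comm (u := y) (v := x)
  have e3 := G.dist_comm (u := y) (v := v)
  have h3 : G.dist v z' + 1 = G.dist v y := by omega
  obtain rfl := hG.eq_of_adj_of_dist_add_one hyz hz' hz h3
  rw [dist_comm, hd, dist_comm]

theorem Hom.edist_le {W : Type*} {H : SimpleGraph W} (f : G →g H) (x y : V) :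
    H.edist (f x) (f y) ≤ G.edist x y := by
  refine le_iInf fun p => ?_
  have := SimpleGraph.edist_le (p.map f)
  rwa [Walk.length_map] at this

theorem Iso.dist_eq {W : Type*} {H : SimpleGraph W} (γ : G ≃g H) (x y : V) :
    H.dist (γ x) (γ y) = G.dist x y := by
  have h : H.edist (γ x) (γ y) = G.edist x y := by
    refine le_antisymm (γ.toHom.edist_le x y) ?_
    simpa using γ.symm.toHom.edist_le (γ x) (γ y)
  rw [SimpleGraph.dist, h, SimpleGraph.dist]

theorem Connected.finite_setOf_dist_le [G.LocallyFinite] (h : G.Connected) (x : V) (n : ℕ) :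
    {y | G.dist x y ≤ n}.Finite := by
  induction n with
  | zero =>
    refine (Set.finite_singleton x).subset fun y hy => ?_
    exact (h.dist_eq_zero_iff.1 (Nat.le_zero.1 hy)).symm
  | succ n ih =>
    refine (ih.union (ih.biUnion fun z _ => (G.neighborSet z).toFinite)).subset fun y hy => ?_
    by_cases hxy : x = y
    · subst hxy; left; simp
    · obtain ⟨z, hz, hd⟩ := h.exists_adj_dist_add_one hxy
      right
      have hy' : G.dist x y ≤ n + 1 := hy
      have : G.dist x z ≤ n := by omega
      exact Set.mem_biUnion this hz.symm

theorem Connected.countable [G.LocallyFinite] (h : G.Connected) : Countable V := by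
  obtain ⟨x⟩ := h.nonempty
  rw [← Set.countable_univ_iff]
  refine (Set.countable_iUnion fun n => (h.finite_setOf_dist_le x n).countable).mono
    fun y _ => Set.mem_iUnion.2 ⟨G.dist x y, le_refl (G.dist x y)⟩

/-- At most one neighbour of a vertex is not farther from `x`, so each vertex has at least `d - 1 ≥
2` children; uniqueness of the parent makes the sets of children disjoint. -/
theorem IsTree.exists_finset_dist_eq [G.LocallyFinite] (hG : G.IsTree) {d : ℕ} (hd : 3 ≤ d)
    (hreg : G.IsRegularOfDegree d) (x : V) (n : ℕ) :
    ∃ S : Finset V, (∀ y ∈ S, G.dist x y = n) ∧ 2 ^ n ≤ S.card := by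
  classical
  induction n with
  | zero => exact ⟨{x}, by simp, by simp⟩
  | succ n ih =>
    obtain ⟨S, hS, hc⟩ := ih
    refine ⟨S.biUnion fun y => (G.neighborFinset y).filter fun z => G.dist x z = n + 1, ?_, ?_⟩
    · intro z hz
      simp only [Finset.mem_biUnion, Finset.mem_filter] at hz
      obtain ⟨_, _, _, h⟩ := hz
      exact h
    rw [Finset.card_biUnion]
    · have : ∀ y ∈ S, 2 ≤ ((G.neighborFinset y).filter fun z => G.dist x z = n + 1).card := by
        intro y hy
        have h1 := Finset.card_filter_add_card_filter_not (s := G.neighborFinset y)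
          (fun z => G.dist x z = n + 1)
        have h2 : ((G.neighborFinset y).filter fun z => ¬ G.dist x z = n + 1).card ≤ 1 := by
          refine Finset.card_le_one.2 fun a ha b hb => ?_
          simp only [Finset.mem_filter, mem_neighborFinset] at ha hb
          have ha' := hG.dist_of_adj x ha.1
          have hb' := hG.dist_of_adj x hb.1
          have := hS y hy
          exact hG.eq_of_adj_of_dist_add_one (x := x) ha.1 hb.1 (by omega) (by omega)
        have h3 : (G.neighborFinset y).card = d := hreg y
        omega
      have := Finset.card_nsmul_le_sum S _ 2 this
      rw [smul_eq_mul] at this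
      calc 2 ^ (n + 1) = 2 ^ n * 2 := pow_succ _ _
        _ ≤ S.card * 2 := Nat.mul_le_mul_right _ hc
        _ ≤ _ := this
    · intro a ha b hb hab
      refine Finset.disjoint_left.2 fun z hza hzb => hab ?_
      simp only [Finset.mem_filter, mem_neighborFinset] at hza hzb
      have h1 := hS a ha
      have h2 := hS b hb
      exact hG.eq_of_adj_of_dist_add_one (x := x) hza.1.symm hzb.1.symm (by omega) (by omega)

/-- Shorten the geodesic at the end `v` until that end reaches `x` or `y`. -/
theorem IsTree.dist_add_dist_of_between (hG : G.IsTree) {w v x y : V}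
    (hx : G.dist w x + G.dist x v = G.dist w v) (hy : G.dist w y + G.dist y v = G.dist w v)
    (h : G.dist w x ≤ G.dist w y) : G.dist w x + G.dist x y = G.dist w y := by
  induction hk : G.dist w v generalizing v with
  | zero =>
    have h1 : w = x := hG.1.dist_eq_zero_iff.1 (by omega)
    have h2 : w = y := hG.1.dist_eq_zero_iff.1 (by omega)
    subst h1 h2
    simp
  | succ k ih =>
    by_cases hyv : y = v
    · rw [hyv]; exact hx
    by_cases hxv : x = v
    · subst hxv
      have : y = x := hG.1.dist_eq_zero_iff.1 (by omega)
      exact absurd this hyv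
    have hwv : w ≠ v := by
      rintro rfl
      simp at hk
    obtain ⟨z, hz, hd⟩ := hG.1.exists_adj_dist_add_one hwv
    have e1 := G.dist_comm (u := x) (v := v)
    have e2 := G.dist_comm (u := w) (v := x)
    have e3 := G.dist_comm (u := v) (v := w)
    have e4 := G.dist_comm (u := y) (v := v)
    have e5 := G.dist_comm (u := w) (v := y)
    have e6 := G.dist_comm (u := x) (v := z)
    have e7 := G.dist_comm (u := y) (v := z)
    have hx' := hG.dist_step_of_between hz hd hxv (by omega)
    have hy' := hG.dist_step_of_between hz hd hyv (by omega)
    exact ih (v := z) (by omega) (by omega) (by omega)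

/-- A geodesic from `w` to `v` has at most `n + 1` vertices if `dist w v ≤ n`. -/
theorem IsTree.card_between_le (hG : G.IsTree) {w v : V} {n : ℕ} (h : G.dist w v ≤ n)
    (S : Finset V) (hS : ∀ x ∈ S, G.dist w x + G.dist x v = G.dist w v) : S.card ≤ n + 1 := by
  have : Set.InjOn (fun x => G.dist w x) (S : Set V) := fun x hx y hy hxy => by
    have hxy' : G.dist w x = G.dist w y := hxy
    have := hG.dist_add_dist_of_between (hS x hx) (hS y hy) hxy'.le
    exact hG.1.dist_eq_zero_iff.1 (by omega)
  calc S.card ≤ (Finset.range (n + 1)).card := by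
        refine Finset.card_le_card_of_injOn _ (fun x hx => ?_) this
        have := hS x hx
        simp only [Finset.coe_range, Set.mem_Iio]
        omega
    _ = n + 1 := Finset.card_range _

theorem Connected.exists_between_dist_eq (h : G.Connected) {x y : V} {k : ℕ}
    (hk : k ≤ G.dist x y) : ∃ z, G.dist x z = k ∧ G.dist x z + G.dist z y = G.dist x y := by
  obtain ⟨m, hm⟩ := Nat.exists_eq_add_of_le hk
  induction m generalizing k with
  | zero => exact ⟨y, by simpa using hm, by simp⟩
  | succ m ih =>
    obtain ⟨z, h1, h2⟩ := ih (k := k + 1) (by omega) (by omega)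
    have hxz : x ≠ z := by
      rintro rfl
      simp at h1
    obtain ⟨u, hu, hd⟩ := h.exists_adj_dist_add_one hxz
    have h3 : G.dist u y ≤ G.dist u z + G.dist z y := h.dist_triangle
    have h4 : G.dist x y ≤ G.dist x u + G.dist u y := h.dist_triangle
    have h5 := dist_eq_one_iff_adj.2 hu.symm
    exact ⟨u, by omega, by omega⟩

/-! ### Partial isometries and automorphisms exchanging two vertices -/

/-- A partial isometry of `G` whose domain and range are geodesically closed, as a relation. -/
structure IsPartialIsometry (G : SimpleGraph V) (R : Set (V × V)) : Prop where
  dist_eq : ∀ p ∈ R, ∀ q ∈ R, G.dist p.1 q.1 = G.dist p.2 q.2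
  dom : ∀ p ∈ R, ∀ q ∈ R, ∀ t, G.dist p.1 t + G.dist t q.1 = G.dist p.1 q.1 → ∃ t', (t, t') ∈ R
  ran : ∀ p ∈ R, ∀ q ∈ R, ∀ t, G.dist p.2 t + G.dist t q.2 = G.dist p.2 q.2 → ∃ t', (t', t) ∈ R

theorem IsPartialIsometry.swap {R : Set (V × V)} (h : G.IsPartialIsometry R) :
    G.IsPartialIsometry (Prod.swap '' R) := by
  refine ⟨?_, ?_, ?_⟩
  · rintro _ ⟨p, hp, rfl⟩ _ ⟨q, hq, rfl⟩
    exact (h.dist_eq p hp q hq).symm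
  · rintro _ ⟨p, hp, rfl⟩ _ ⟨q, hq, rfl⟩ t ht
    obtain ⟨t', h'⟩ := h.ran p hp q hq t ht
    exact ⟨t', _, h', rfl⟩
  · rintro _ ⟨p, hp, rfl⟩ _ ⟨q, hq, rfl⟩ t ht
    obtain ⟨t', h'⟩ := h.dom p hp q hq t ht
    exact ⟨t', _, h', rfl⟩

/-- The flip of the geodesic from `x` to `y` is the seed that Zorn's lemma extends to an
automorphism. -/
theorem IsTree.isPartialIsometry_reverse (hG : G.IsTree) (x y : V) :
    G.IsPartialIsometry {p | G.dist x p.1 + G.dist p.1 y = G.dist x y ∧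
      G.dist x p.2 + G.dist p.2 y = G.dist x y ∧ G.dist x p.2 = G.dist p.1 y} := by
  have closed : ∀ u v t, G.dist x u + G.dist u y = G.dist x y →
      G.dist x v + G.dist v y = G.dist x y → G.dist u t + G.dist t v = G.dist u v →
      G.dist x t + G.dist t y = G.dist x y := by
    have key : ∀ u v t, G.dist x u ≤ G.dist x v → G.dist x u + G.dist u y = G.dist x y →
        G.dist x v + G.dist v y = G.dist x y → G.dist u t + G.dist t v = G.dist u v →
        G.dist x t + G.dist t y = G.dist x y := by
      intro u v t huv hu hv ht
      have h1 := hG.dist_add_dist_of_between hu hv huv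
      have h2 : G.dist x t ≤ G.dist x u + G.dist u t := hG.1.dist_triangle
      have h3 : G.dist t y ≤ G.dist t v + G.dist v y := hG.1.dist_triangle
      have h4 : G.dist x y ≤ G.dist x t + G.dist t y := hG.1.dist_triangle
      omega
    intro u v t hu hv ht
    rcases le_total (G.dist x u) (G.dist x v) with h | h
    · exact key u v t h hu hv ht
    · refine key v u t h hv hu ?_
      rw [dist_comm (u := v) (v := t), dist_comm (u := t) (v := u), dist_comm (u := v) (v := u)]
      omega
  refine ⟨?_, ?_, ?_⟩
  · rintro ⟨u, u'⟩ ⟨hu, hu', h⟩ ⟨v, v'⟩ ⟨hv, hv', h'⟩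
    dsimp only at *
    have e1 := G.dist_comm (u := u) (v := v)
    have e2 := G.dist_comm (u := u') (v := v')
    rcases le_total (G.dist x u) (G.dist x v) with huv | huv
    · have h1 := hG.dist_add_dist_of_between hu hv huv
      have h2 := hG.dist_add_dist_of_between hv' hu' (by omega)
      omega
    · have h1 := hG.dist_add_dist_of_between hv hu huv
      have h2 := hG.dist_add_dist_of_between hu' hv' (by omega)
      omega
  · rintro ⟨u, u'⟩ ⟨hu, hu', h⟩ ⟨v, v'⟩ ⟨hv, hv', h'⟩ t ht
    have := closed u v t hu hv ht
    obtain ⟨t', h1, h2⟩ := hG.1.exists_between_dist_eq (x := x) (y := y) (k := G.dist t y) (by omega)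
    exact ⟨t', this, h2, h1⟩
  · rintro ⟨u, u'⟩ ⟨hu, hu', h⟩ ⟨v, v'⟩ ⟨hv, hv', h'⟩ t ht
    have := closed u' v' t hu' hv' ht
    obtain ⟨t', h1, h2⟩ := hG.1.exists_between_dist_eq (x := x) (y := y) (k := G.dist t y) (by omega)
    refine ⟨t', h2, this, ?_⟩
    dsimp only
    omega

/-- In a regular tree a partial isometry extends to any neighbour of its domain. -/
theorem IsTree.exists_extend_partialIsometry [G.LocallyFinite] (hG : G.IsTree) {d : ℕ}
    (hreg : G.IsRegularOfDegree d) {R : Set (V × V)} (hR : G.IsPartialIsometry R) {u u' w : V}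
    (hu : (u, u') ∈ R) (huw : G.Adj u w) (hw : ∀ w', (w, w') ∉ R) :
    ∃ w', G.IsPartialIsometry (insert (w, w') R) := by
  classical
  have hinj : ∀ p ∈ R, ∀ q ∈ R, p.2 = q.2 → p.1 = q.1 := by
    intro p hp q hq h
    have := hR.dist_eq p hp q hq
    rw [h, dist_self] at this
    exact hG.1.dist_eq_zero_iff.1 this
  -- Otherwise preimages inject the `d` neighbours of `u'` into the neighbours of `u` other than
  -- `w`, of which there are only `d - 1`.
  obtain ⟨w', huw', hw'⟩ : ∃ w', G.Adj u' w' ∧ ∀ t, (t, w') ∉ R := by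
    by_contra! hcon
    choose! f hf using hcon
    have hmaps : ∀ a ∈ G.neighborFinset u', f a ∈ (G.neighborFinset u).erase w := by
      intro a ha
      rw [mem_neighborFinset] at ha
      refine Finset.mem_erase.2 ⟨?_, ?_⟩
      · intro h
        exact hw a (h ▸ hf a ha)
      · rw [mem_neighborFinset, ← dist_eq_one_iff_adj, hR.dist_eq _ hu _ (hf a ha)]
        exact dist_eq_one_iff_adj.2 ha
    have hfinj : Set.InjOn f (G.neighborFinset u') := by
      intro a ha b hb hab
      simp only [Finset.mem_coe, mem_neighborFinset] at ha hb
      have := hR.dist_eq _ (hf a ha) _ (hf b hb)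
      dsimp only at this
      rw [hab, dist_self] at this
      exact hG.1.dist_eq_zero_iff.1 this.symm
    have h1 := Finset.card_le_card_of_injOn f hmaps hfinj
    have h2 : w ∈ G.neighborFinset u := by simpa using huw
    have h3 := Finset.card_erase_lt_of_mem h2
    have h4 : (G.neighborFinset u).card = d := hreg u
    have h5 : (G.neighborFinset u').card = d := hreg u'
    omega
  refine ⟨w', ?_⟩
  -- If `w` were closer than `u`, it would lie between two points of the domain, which is
  -- geodesically closed.
  have hdom : ∀ p ∈ R, G.dist p.1 w = G.dist p.1 u + 1 := by
    intro p hp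
    refine (hG.dist_of_adj p.1 huw).resolve_left fun h => ?_
    obtain ⟨t, ht⟩ := hR.dom p hp _ hu w
      (by rw [dist_eq_one_iff_adj.2 huw.symm, h])
    exact hw t ht
  have hran : ∀ p ∈ R, G.dist p.2 w' = G.dist p.2 u' + 1 := by
    intro p hp
    refine (hG.dist_of_adj p.2 huw').resolve_left fun h => ?_
    obtain ⟨t, ht⟩ := hR.ran p hp _ hu w'
      (by rw [dist_eq_one_iff_adj.2 huw'.symm, h])
    exact hw' t ht
  have step : ∀ {a b c t : V}, G.Adj b c → G.dist a c = G.dist a b + 1 → t ≠ c →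
      G.dist a t + G.dist t c = G.dist a c → G.dist a t + G.dist t b = G.dist a b := by
    intro a b c t hbc hac htc ht
    have e1 := G.dist_comm (u := a) (v := t)
    have e2 := G.dist_comm (u := t) (v := c)
    have e3 := G.dist_comm (u := a) (v := c)
    have e4 := G.dist_comm (u := t) (v := b)
    have := hG.dist_step_of_between (v := a) hbc.symm (by omega) htc (by omega)
    omega
  refine ⟨?_, ?_, ?_⟩
  · rintro p (rfl | hp) q (rfl | hq)
    · simp
    · rw [dist_comm, hdom q hq, dist_comm (u := w'), hran q hq, hR.dist_eq q hq _ hu]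
    · rw [hdom p hp, hran p hp, hR.dist_eq p hp _ hu]
    · exact hR.dist_eq p hp q hq
  · have key : ∀ q ∈ R, ∀ t, G.dist q.1 t + G.dist t w = G.dist q.1 w →
        ∃ t', (t, t') ∈ insert (w, w') R := by
      intro q hq t ht
      by_cases htw : t = w
      · exact ⟨w', by simp [htw]⟩
      · obtain ⟨t', h⟩ := hR.dom q hq _ hu t (step huw (hdom q hq) htw ht)
        exact ⟨t', Or.inr h⟩
    rintro p (rfl | hp) q (rfl | hq) t ht
    · have : t = w := by
        dsimp only at ht
        rw [dist_self] at ht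
        exact hG.1.dist_eq_zero_iff.1 (by omega)
      exact ⟨w', by simp [this]⟩
    · refine key q hq t ?_
      rw [dist_comm (u := q.1) (v := t), dist_comm (u := t) (v := w),
        dist_comm (u := q.1) (v := w), add_comm]
      exact ht
    · exact key p hp t ht
    · obtain ⟨t', h⟩ := hR.dom p hp q hq t ht
      exact ⟨t', Or.inr h⟩
  · have key : ∀ q ∈ R, ∀ t, G.dist q.2 t + G.dist t w' = G.dist q.2 w' →
        ∃ t', (t', t) ∈ insert (w, w') R := by
      intro q hq t ht
      by_cases htw : t = w'
      · exact ⟨w, by simp [htw]⟩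
      · obtain ⟨t', h⟩ := hR.ran q hq _ hu t (step huw' (hran q hq) htw ht)
        exact ⟨t', Or.inr h⟩
    rintro p (rfl | hp) q (rfl | hq) t ht
    · have : t = w' := by
        dsimp only at ht
        rw [dist_self] at ht
        exact hG.1.dist_eq_zero_iff.1 (by omega)
      exact ⟨w, by simp [this]⟩
    · refine key q hq t ?_
      rw [dist_comm (u := q.2) (v := t), dist_comm (u := t) (v := w'),
        dist_comm (u := q.2) (v := w'), add_comm]
      exact ht
    · exact key p hp t ht
    · obtain ⟨t', h⟩ := hR.ran p hp q hq t ht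
      exact ⟨t', Or.inr h⟩

theorem IsPartialIsometry.sUnion {c : Set (Set (V × V))} (hc : IsChain (· ⊆ ·) c)
    (h : ∀ R ∈ c, G.IsPartialIsometry R) : G.IsPartialIsometry (⋃₀ c) := by
  have common : ∀ p ∈ ⋃₀ c, ∀ q ∈ ⋃₀ c, ∃ R ∈ c, p ∈ R ∧ q ∈ R := by
    rintro p ⟨R, hR, hp⟩ q ⟨S, hS, hq⟩
    rcases hc.total hR hS with h' | h'
    · exact ⟨S, hS, h' hp, hq⟩
    · exact ⟨R, hR, hp, h' hq⟩
  refine ⟨?_, ?_, ?_⟩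
  · intro p hp q hq
    obtain ⟨R, hR, hp, hq⟩ := common p hp q hq
    exact (h R hR).dist_eq p hp q hq
  · intro p hp q hq t ht
    obtain ⟨R, hR, hp, hq⟩ := common p hp q hq
    obtain ⟨t', h'⟩ := (h R hR).dom p hp q hq t ht
    exact ⟨t', R, hR, h'⟩
  · intro p hp q hq t ht
    obtain ⟨R, hR, hp, hq⟩ := common p hp q hq
    obtain ⟨t', h'⟩ := (h R hR).ran p hp q hq t ht
    exact ⟨t', R, hR, h'⟩

/-- Any two vertices of a regular tree are exchanged by an automorphism. -/
theorem IsTree.exists_iso_swap [G.LocallyFinite] (hG : G.IsTree) {d : ℕ}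
    (hreg : G.IsRegularOfDegree d) (x y : V) : ∃ γ : G ≃g G, γ x = y ∧ γ y = x := by
  obtain ⟨R, hsub, hR⟩ := zorn_subset_nonempty {R : Set (V × V) | G.IsPartialIsometry R}
    (fun c hc hchain _ => ⟨⋃₀ c, IsPartialIsometry.sUnion hchain hc,
      fun s hs => Set.subset_sUnion_of_mem hs⟩) _ (hG.isPartialIsometry_reverse x y)
  have hxy : (x, y) ∈ R := hsub (by simp)
  have hyx : (y, x) ∈ R := hsub (by simp [dist_comm])
  have total : ∀ {S : Set (V × V)} {a b : V}, Maximal G.IsPartialIsometry S → (a, b) ∈ S →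
      ∀ w, ∃ w', (w, w') ∈ S := by
    intro S a b hS hab w
    induction hk : G.dist a w generalizing w with
    | zero => exact ⟨b, (hG.1.dist_eq_zero_iff.1 hk) ▸ hab⟩
    | succ k ih =>
      have hne : a ≠ w := by
        rintro rfl
        simp at hk
      obtain ⟨u, hu, hd⟩ := hG.1.exists_adj_dist_add_one hne
      obtain ⟨u', hu'⟩ := ih u (by omega)
      by_contra! hcon
      obtain ⟨w', hw'⟩ := hG.exists_extend_partialIsometry hreg hS.1 hu' hu.symm hcon
      exact hcon w' (hS.2 hw' (Set.subset_insert _ _) (Set.mem_insert _ _))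
  -- The inverse relation is maximal too, so `total` applied to it gives surjectivity.
  have hRs : Maximal G.IsPartialIsometry (Prod.swap '' R) := by
    refine ⟨hR.1.swap, fun S hS hle => ?_⟩
    have h1 : Prod.swap '' S ⊆ R := hR.2 hS.swap fun p hp =>
      ⟨p.swap, hle ⟨p, hp, rfl⟩, Prod.swap_swap p⟩
    exact fun p hp => ⟨p.swap, h1 ⟨p, hp, rfl⟩, Prod.swap_swap p⟩
  choose f hf using total hR hxy
  have hg : ∀ w, ∃ w', (w', w) ∈ R := fun w => by
    obtain ⟨w', p, hp, h⟩ := total hRs ⟨(x, y), hxy, rfl⟩ w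
    obtain rfl : p = (w', w) := by rw [← Prod.swap_swap p, h]; rfl
    exact ⟨w', hp⟩
  have func : ∀ {a b b' : V}, (a, b) ∈ R → (a, b') ∈ R → b = b' := by
    intro a b b' h h'
    have := hR.1.dist_eq _ h _ h'
    rw [dist_self] at this
    exact hG.1.dist_eq_zero_iff.1 this.symm
  have hdist : ∀ a b, G.dist (f a) (f b) = G.dist a b := fun a b =>
    (hR.1.dist_eq _ (hf a) _ (hf b)).symm
  have hbij : Function.Bijective f := by
    refine ⟨fun a b h => ?_, fun w => ?_⟩
    · have := hdist a b
      rw [h, dist_self] at this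
      exact hG.1.dist_eq_zero_iff.1 this.symm
    · obtain ⟨w', h⟩ := hg w
      exact ⟨w', func (hf w') h⟩
  refine ⟨⟨Equiv.ofBijective f hbij, ?_⟩, func (hf x) hxy, func (hf y) hyx⟩
  intro a b
  rw [← dist_eq_one_iff_adj, ← dist_eq_one_iff_adj]
  exact Iff.of_eq (congrArg (· = 1) (hdist a b))

end SimpleGraph

/-! ### Augmenting geodesics and flows into sinks -/

namespace SimpleGraph

variable {V : Type*} (G : SimpleGraph V)

/-- The relation `R` contains exactly one of the two directions of each edge of `G`. -/
structure Orients (R : V → V → Prop) : Prop where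
  adj : ∀ {x y}, R x y → G.Adj x y
  iff_not : ∀ {x y}, G.Adj x y → (R x y ↔ ¬ R y x)

/-- The step from `x` to `y` is part of the geodesic from `w` to `v`. -/
def OnGeodesic (w v x y : V) : Prop := G.dist w x + 1 + G.dist y v = G.dist w v

/-- All edges on the geodesic from `w` to `v` point towards `v`, and its vertices before `v`,
except possibly `w`, have out-degree one. -/
def Channel (R : V → V → Prop) (w v : V) : Prop :=
  ∀ x z, G.Adj x z → G.OnGeodesic w v x z → R x z ∧ (x ≠ w → ∀ z', R x z' → z' = z)

/-- All edges on the geodesic from `w` to `v` point towards `v`, and all its vertices before `v`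
have out-degree one. -/
def FlowsTo (R : V → V → Prop) (w v : V) : Prop :=
  ∀ x z, G.Adj x z → G.OnGeodesic w v x z → R x z ∧ ∀ z', R x z' → z' = z

/-- The geodesic from `w` to the sink `v` has length at most `n` and can be reversed without
creating a sink. -/
def Augments (R : V → V → Prop) (n : ℕ) (w v : V) : Prop :=
  G.dist w v ≤ n ∧ (∀ y, ¬ R v y) ∧ (∃ y z, y ≠ z ∧ R w y ∧ R w z) ∧ G.Channel R w v

variable {G} {R : V → V → Prop}

theorem Orients.asymm (hR : G.Orients R) {x y : V} (h : R x y) : ¬ R y x :=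
  (hR.iff_not (hR.adj h)).1 h

theorem FlowsTo.refl (v : V) : G.FlowsTo R v v := by
  intro x z _ h
  simp [OnGeodesic] at h

theorem Connected.dist_triangle_le (h : G.Connected) (x y z : V) :
    G.dist x z ≤ G.dist x y + G.dist y z := h.dist_triangle

theorem Connected.onGeodesic_of_step (h : G.Connected) {y z v a b : V} (hyz : G.Adj y z)
    (hd : G.dist v z + 1 = G.dist v y) (hab : G.Adj a b) (hg : G.OnGeodesic z v a b) :
    G.OnGeodesic y v a b := by
  unfold OnGeodesic at *
  have h1 := h.dist_triangle_le y z a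
  have h2 := h.dist_triangle_le y a v
  have h3 := h.dist_triangle_le a b v
  have h4 := dist_eq_one_iff_adj.2 hyz
  have h5 := dist_eq_one_iff_adj.2 hab
  have h6 := G.dist_comm (u := v) (v := z)
  have h7 := G.dist_comm (u := v) (v := y)
  omega

theorem onGeodesic_start {y z v : V}
    (hd : G.dist v z + 1 = G.dist v y) : G.OnGeodesic y v y z := by
  unfold OnGeodesic
  rw [dist_self, dist_comm (u := z), dist_comm (u := y)]
  omega

theorem Connected.between_of_onGeodesic (h : G.Connected) {w v a b : V} (hab : G.Adj a b)
    (hg : G.OnGeodesic w v a b) : G.dist w a + G.dist a v = G.dist w v ∧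
      G.dist w b + G.dist b v = G.dist w v ∧ G.dist a v = G.dist b v + 1 ∧
      G.dist w b = G.dist w a + 1 := by
  unfold OnGeodesic at *
  have h1 := h.dist_triangle_le w a v
  have h2 := h.dist_triangle_le w b v
  have h3 := h.dist_triangle_le a b v
  have h4 := h.dist_triangle_le w a b
  have h5 := dist_eq_one_iff_adj.2 hab
  omega

theorem IsTree.onGeodesic_step (hG : G.IsTree) {y z v a b : V} (hyz : G.Adj y z)
    (hd : G.dist v z + 1 = G.dist v y) (hab : G.Adj a b) (hg : G.OnGeodesic y v a b)
    (hay : a ≠ y) : G.OnGeodesic z v a b := by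
  obtain ⟨h1, -, -, -⟩ := hG.1.between_of_onGeodesic hab hg
  have := hG.dist_step_of_between hyz hd hay h1
  have h6 := G.dist_comm (u := v) (v := z)
  have h7 := G.dist_comm (u := v) (v := y)
  unfold OnGeodesic at *
  omega

theorem IsTree.eq_of_onGeodesic_left (hG : G.IsTree) {w v a b b' : V} (hb : G.Adj a b)
    (hb' : G.Adj a b') (h : G.OnGeodesic w v a b) (h' : G.OnGeodesic w v a b') : b = b' := by
  have h1 := hG.1.between_of_onGeodesic hb h
  have h2 := hG.1.between_of_onGeodesic hb' h'
  have e1 := G.dist_comm (u := v) (v := a)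
  have e2 := G.dist_comm (u := v) (v := b)
  have e3 := G.dist_comm (u := v) (v := b')
  exact hG.eq_of_adj_of_dist_add_one (x := v) hb hb' (by omega) (by omega)

theorem IsTree.eq_of_onGeodesic_right (hG : G.IsTree) {w v a b b' : V} (hb : G.Adj b a)
    (hb' : G.Adj b' a) (h : G.OnGeodesic w v b a) (h' : G.OnGeodesic w v b' a) : b = b' := by
  have h1 := hG.1.between_of_onGeodesic hb h
  have h2 := hG.1.between_of_onGeodesic hb' h'
  exact hG.eq_of_adj_of_dist_add_one (x := w) hb.symm hb'.symm (by omega) (by omega)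

theorem Connected.exists_onGeodesic_next (h : G.Connected) {w v a : V} (hav : a ≠ v)
    (hg : G.dist w a + G.dist a v = G.dist w v) : ∃ b, G.Adj a b ∧ G.OnGeodesic w v a b := by
  obtain ⟨b, hb, hd⟩ := h.exists_adj_dist_add_one hav.symm
  refine ⟨b, hb, ?_⟩
  unfold OnGeodesic
  rw [dist_comm (u := b)]
  rw [dist_comm (u := a)] at hg
  omega

theorem Connected.exists_onGeodesic_prev (h : G.Connected) {w v a : V} (haw : a ≠ w)
    (hg : G.dist w a + G.dist a v = G.dist w v) : ∃ b, G.Adj b a ∧ G.OnGeodesic w v b a := by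
  obtain ⟨b, hb, hd⟩ := h.exists_adj_dist_add_one haw.symm
  refine ⟨b, hb.symm, ?_⟩
  unfold OnGeodesic
  omega

theorem Connected.flowsTo_step (h : G.Connected) {y v : V} (hf : G.FlowsTo R y v) (hne : y ≠ v) :
    ∃ z, G.Adj y z ∧ G.dist v z + 1 = G.dist v y ∧ R y z ∧ (∀ z', R y z' → z' = z) ∧
      G.FlowsTo R z v := by
  obtain ⟨z, hz, hd⟩ := h.exists_adj_dist_add_one hne.symm
  obtain ⟨h1, h2⟩ := hf y z hz (onGeodesic_start hd)
  exact ⟨z, hz, hd, h1, h2, fun a b hab hg => hf a b hab (h.onGeodesic_of_step hz hd hab hg)⟩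

/-- Out-degree one forces every step from `y`, and the forced walk can stop only at a sink. -/
theorem Connected.flowsTo_unique (h : G.Connected) {y v v' : V} (hv : ∀ z, ¬ R v z)
    (hv' : ∀ z, ¬ R v' z) (hf : G.FlowsTo R y v) (hf' : G.FlowsTo R y v') : v = v' := by
  induction hk : G.dist v y generalizing y with
  | zero =>
    obtain rfl := h.dist_eq_zero_iff.1 hk
    by_contra hne
    obtain ⟨z, -, -, hz, -⟩ := h.flowsTo_step hf' hne
    exact hv z hz
  | succ k ih =>
    have hne : y ≠ v := by
      rintro rfl
      simp at hk
    obtain ⟨z, -, hd, hz, huniq, hfz⟩ := h.flowsTo_step hf hne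
    have hne' : y ≠ v' := by
      rintro rfl
      exact hv' z hz
    obtain ⟨z', -, -, hz', -, hfz'⟩ := h.flowsTo_step hf' hne'
    obtain rfl := huniq z' hz'
    exact ih hfz hfz' (by omega)

theorem IsTree.flowsTo_of_step (hG : G.IsTree) {y z v : V} (hyz : G.Adj y z)
    (hd : G.dist v z + 1 = G.dist v y) (hR : R y z) (hu : ∀ z', R y z' → z' = z)
    (hf : G.FlowsTo R z v) : G.FlowsTo R y v := by
  intro a b hab hg
  by_cases hay : a = y
  · subst hay
    obtain rfl := hG.eq_of_onGeodesic_left hab hyz hg (onGeodesic_start hd)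
    exact ⟨hR, hu⟩
  · exact hf a b hab (hG.onGeodesic_step hyz hd hab hg hay)

theorem IsTree.channel_of_step (hG : G.IsTree) {y z v : V} (hyz : G.Adj y z)
    (hd : G.dist v z + 1 = G.dist v y) (hR : R y z) (hf : G.FlowsTo R z v) :
    G.Channel R y v := by
  intro a b hab hg
  by_cases hay : a = y
  · subst hay
    obtain rfl := hG.eq_of_onGeodesic_left hab hyz hg (onGeodesic_start hd)
    exact ⟨hR, fun h => absurd rfl h⟩
  · obtain ⟨h1, h2⟩ := hf a b hab (hG.onGeodesic_step hyz hd hab hg hay)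
    exact ⟨h1, fun _ => h2⟩

theorem Connected.channel_step (h : G.Connected) {w v : V} (hc : G.Channel R w v) (hne : w ≠ v) :
    ∃ y, G.Adj w y ∧ R w y ∧ G.FlowsTo R y v := by
  obtain ⟨y, hy, hd⟩ := h.exists_adj_dist_add_one hne.symm
  refine ⟨y, hy, (hc w y hy (onGeodesic_start hd)).1, fun a b hab hg => ?_⟩
  obtain ⟨h1, h2⟩ := hc a b hab (h.onGeodesic_of_step hy hd hab hg)
  refine ⟨h1, h2 ?_⟩
  rintro rfl
  have := (h.between_of_onGeodesic hab hg).1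
  have e1 := G.dist_comm (u := v) (v := a)
  have e2 := G.dist_comm (u := v) (v := y)
  omega

theorem Augments.ne {n : ℕ} {w v : V} (h : G.Augments R n w v) : w ≠ v := by
  rintro rfl
  obtain ⟨-, hs, ⟨y, _, _, hy, _⟩, _⟩ := h
  exact hs y hy

/-- If a sink has no augmenting geodesic of length at most `n`, then its `n`-ball flows into it. -/
theorem IsTree.flowsTo_of_forall_not_augments (hG : G.IsTree) (hR : G.Orients R) {n : ℕ} {v : V}
    (hv : ∀ y, ¬ R v y) (hn : ∀ w, ¬ G.Augments R n w v) {y : V} (hy : G.dist v y ≤ n) :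
    G.FlowsTo R y v := by
  induction hk : G.dist v y generalizing y with
  | zero =>
    obtain rfl := hG.1.dist_eq_zero_iff.1 hk
    exact FlowsTo.refl _
  | succ k ih =>
    have hne : v ≠ y := by
      rintro rfl
      simp at hk
    obtain ⟨z, hz, hd⟩ := hG.1.exists_adj_dist_add_one hne
    have hfz := ih (y := z) (by omega) (by omega)
    -- An edge from `z` to `y` is impossible: `z` is either the sink `v` or has its only out-edge
    -- towards `v`.
    have hyz : R y z := by
      rw [hR.iff_not hz]
      intro hzy
      by_cases hzv : z = v
      · subst hzv
        exact hv y hzy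
      · obtain ⟨z', -, hd', -, hu, -⟩ := hG.1.flowsTo_step hfz hzv
        obtain rfl := hu y hzy
        omega
    -- A second out-edge at `y` would make `y` the start of an augmenting geodesic.
    by_cases hu : ∀ z', R y z' → z' = z
    · exact hG.flowsTo_of_step hz hd hyz hu hfz
    · push Not at hu
      obtain ⟨z', hz', hne'⟩ := hu
      refine absurd ⟨?_, hv, ⟨z', z, hne', hz', hyz⟩, hG.channel_of_step hz hd hyz hfz⟩ (hn y)
      rwa [dist_comm]

/-- After the first step from `w` the flow is forced, so that step determines the sink. -/
theorem Connected.card_le_of_augments [G.LocallyFinite] (h : G.Connected) {n : ℕ} {w : V}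
    (S : Finset V) (hS : ∀ v ∈ S, G.Augments R n w v) : S.card ≤ G.degree w := by
  have hstep : ∀ v ∈ S, ∃ y, G.Adj w y ∧ R w y ∧ G.FlowsTo R y v := fun v hv =>
    h.channel_step (hS v hv).2.2.2 (hS v hv).ne
  choose! f hf using hstep
  refine Finset.card_le_card_of_injOn f (fun v hv => ?_) ?_
  · simpa using (hf v hv).1
  · intro v hv v' hv' hvv'
    have h1 := (hf v hv).2.2
    have h2 := (hf v' hv').2.2
    rw [← hvv'] at h2
    exact h.flowsTo_unique (hS v hv).2.1 (hS v' hv').2.1 h1 h2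

/-! ### Simultaneous reversal along a matching -/

variable (G R)

/-- A set of pairs `(v, w)` such that the geodesics from `w` to `v` can be reversed
simultaneously. -/
structure IsAugmentingMatching (n : ℕ) (M : V → V → Prop) : Prop where
  augments : ∀ {v w}, M v w → G.Augments R n w v
  left : ∀ {v w w'}, M v w → M v w' → w = w'
  right : ∀ {v v' w}, M v w → M v' w → v = v'

/-- The edge `{x, y}` is on one of the geodesics given by `M`. -/
def OnSome (M : V → V → Prop) (x y : V) : Prop :=
  ∃ v w, M v w ∧ (G.OnGeodesic w v x y ∨ G.OnGeodesic w v y x)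

/-- The relation obtained from `R` by reversing all edges on the geodesics given by `M`. -/
def reverseAlong (M : V → V → Prop) (x y : V) : Prop :=
  (G.OnSome M x y ∧ R y x) ∨ (¬ G.OnSome M x y ∧ R x y)

variable {G R} {n : ℕ} {M : V → V → Prop}

theorem onSome_comm {x y : V} : G.OnSome M x y ↔ G.OnSome M y x := by
  simp only [OnSome, or_comm]

theorem reverseAlong_of_onSome {x y : V} (h : G.OnSome M x y) :
    G.reverseAlong R M x y ↔ R y x := by simp [reverseAlong, h]

theorem reverseAlong_of_not_onSome {x y : V} (h : ¬ G.OnSome M x y) :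
    G.reverseAlong R M x y ↔ R x y := by simp [reverseAlong, h]

theorem Orients.reverseAlong (hR : G.Orients R) : G.Orients (G.reverseAlong R M) := by
  constructor
  · rintro x y (⟨_, h⟩ | ⟨_, h⟩)
    · exact (hR.adj h).symm
    · exact hR.adj h
  · intro x y hxy
    by_cases h : G.OnSome M x y
    · rw [reverseAlong_of_onSome h, reverseAlong_of_onSome (onSome_comm.1 h), hR.iff_not hxy.symm]
    · rw [reverseAlong_of_not_onSome h, reverseAlong_of_not_onSome (fun h' => h (onSome_comm.1 h')),
        hR.iff_not hxy]

theorem IsAugmentingMatching.rel (hM : G.IsAugmentingMatching R n M) {v w x y : V} (h : M v w)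
    (hxy : G.Adj x y) (hg : G.OnGeodesic w v x y) : R x y :=
  ((hM.augments h).2.2.2 x y hxy hg).1

theorem IsAugmentingMatching.reverseAlong_of_onGeodesic (hM : G.IsAugmentingMatching R n M)
    {v w x y : V} (h : M v w) (hxy : G.Adj x y) (hg : G.OnGeodesic w v x y) :
    G.reverseAlong R M y x :=
  (reverseAlong_of_onSome ⟨v, w, h, Or.inr hg⟩).2 (hM.rel h hxy hg)

/-- An edge on one of the geodesics points along it. -/
theorem IsAugmentingMatching.exists_onGeodesic (hM : G.IsAugmentingMatching R n M)
    (hR : G.Orients R) {x y : V} (hxy : R x y) (h : G.OnSome M x y) :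
    ∃ v w, M v w ∧ G.OnGeodesic w v x y := by
  obtain ⟨v, w, hvw, hg | hg⟩ := h
  · exact ⟨v, w, hvw, hg⟩
  · exact absurd (hM.rel hvw (hR.adj hxy).symm hg) (hR.asymm hxy)

theorem IsAugmentingMatching.not_sink_of_mem (hM : G.IsAugmentingMatching R n M)
    (hG : G.IsTree) {v w : V} (h : M v w) : ∃ y, G.reverseAlong R M v y := by
  obtain ⟨y, hy, hg⟩ := hG.1.exists_onGeodesic_prev (w := w) (v := v) (hM.augments h).ne.symm
    (by rw [dist_self, add_zero])
  exact ⟨y, hM.reverseAlong_of_onGeodesic h hy hg⟩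

/-- If an out-edge of `x` is reversed, `x` is inside a geodesic or at its start. Inside, the
reversed incoming edge leaves `x`; at the start, a second out-edge survives. -/
theorem IsAugmentingMatching.not_sink (hM : G.IsAugmentingMatching R n M) (hR : G.Orients R)
    (hG : G.IsTree) {x : V} (h : ∃ y, R x y) : ∃ y, G.reverseAlong R M x y := by
  obtain ⟨y, hy⟩ := h
  by_cases hs : G.OnSome M x y
  swap
  · exact ⟨y, (reverseAlong_of_not_onSome hs).2 hy⟩
  obtain ⟨v, w, hvw, hg⟩ := hM.exists_onGeodesic hR hy hs
  have hxy := hR.adj hy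
  by_cases hxw : x = w
  · subst hxw
    obtain ⟨y', hne, hy'⟩ : ∃ y', y' ≠ y ∧ R x y' := by
      obtain ⟨a, b, hab, ha, hb⟩ := (hM.augments hvw).2.2.1
      by_cases hay : a = y
      · exact ⟨b, fun h => hab (hay.trans h.symm), hb⟩
      · exact ⟨a, hay, ha⟩
    -- A geodesic through the second out-edge would either start at `x`, against the matching, or
    -- have `x` as an inner vertex of out-degree two.
    refine ⟨y', (reverseAlong_of_not_onSome fun hs' => ?_).2 hy'⟩
    obtain ⟨v', w', hvw', hg'⟩ := hM.exists_onGeodesic hR hy' hs'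
    by_cases hw' : x = w'
    · subst hw'
      obtain rfl := hM.right hvw hvw'
      exact hne (hG.eq_of_onGeodesic_left (hR.adj hy') hxy hg' hg)
    · have := ((hM.augments hvw').2.2.2 x y' (hR.adj hy') hg').2 hw' y hy
      exact hne this.symm
  · obtain ⟨z, hz, hgz⟩ := hG.1.exists_onGeodesic_prev hxw (hG.1.between_of_onGeodesic hxy hg).1
    exact ⟨z, hM.reverseAlong_of_onGeodesic hvw hz hgz⟩

/-- If an in-edge of `x` is reversed and `x` is not the end of the geodesic, the next edge becomes
incoming. If `x` is the end, it was a sink, and its other edges stay incoming. -/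
theorem IsAugmentingMatching.not_source (hM : G.IsAugmentingMatching R n M) (hR : G.Orients R)
    (hG : G.IsTree) {x : V} (hx : ∀ y, ∃ y', G.Adj x y' ∧ y' ≠ y) (h : ∃ y, R y x) :
    ∃ y, G.reverseAlong R M y x := by
  obtain ⟨y, hy⟩ := h
  by_cases hs : G.OnSome M y x
  swap
  · exact ⟨y, (reverseAlong_of_not_onSome hs).2 hy⟩
  obtain ⟨v, w, hvw, hg⟩ := hM.exists_onGeodesic hR hy hs
  have hyx := hR.adj hy
  by_cases hxv : x = v
  · subst hxv
    obtain ⟨y', hadj, hne⟩ := hx y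
    have hsink := (hM.augments hvw).2.1
    have hy' : R y' x := (hR.iff_not hadj.symm).2 (hsink y')
    refine ⟨y', (reverseAlong_of_not_onSome fun hs' => ?_).2 hy'⟩
    obtain ⟨v', w', hvw', hg'⟩ := hM.exists_onGeodesic hR hy' hs'
    by_cases hv' : x = v'
    · subst hv'
      obtain rfl := hM.left hvw hvw'
      exact hne (hG.eq_of_onGeodesic_right hadj.symm hyx hg' hg)
    · obtain ⟨z, hz, hgz⟩ :=
        hG.1.exists_onGeodesic_next hv' (hG.1.between_of_onGeodesic hadj.symm hg').2.1
      exact hsink z (hM.rel hvw' hz hgz)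
  · obtain ⟨z, hz, hgz⟩ := hG.1.exists_onGeodesic_next hxv (hG.1.between_of_onGeodesic hyx hg).2.1
    exact ⟨z, hM.reverseAlong_of_onGeodesic hvw hz hgz⟩

theorem Connected.not_onSome_of_forall_not_between (hG : G.Connected) {x y : V} (hxy : G.Adj x y)
    (h : ∀ v w, M v w → G.dist w x + G.dist x v ≠ G.dist w v) : ¬ G.OnSome M x y := by
  rintro ⟨v, w, hvw, hg | hg⟩
  · exact h v w hvw (hG.between_of_onGeodesic hxy hg).1
  · exact h v w hvw (hG.between_of_onGeodesic hxy.symm hg).2.1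

/-! ### Choosing the matching from labels -/

variable (G R)

/-- The sink `v` requests its augmenting geodesic with the smallest label of the other end `w`. -/
def Requests (ℓ : V → ℝ) (n : ℕ) (v w : V) : Prop :=
  G.Augments R n w v ∧ ∀ w', G.Augments R n w' v → w' ≠ w → ℓ w < ℓ w'

/-- Among the sinks that request `w`, the sink `v` has the smallest label. -/
def Selects (ℓ : V → ℝ) (n : ℕ) (v w : V) : Prop :=
  G.Requests R ℓ n v w ∧ ∀ v', G.Requests R ℓ n v' w → v' ≠ v → ℓ v < ℓ v'

variable {G R} {ℓ : V → ℝ}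

theorem Requests.unique {v w w' : V} (h : G.Requests R ℓ n v w) (h' : G.Requests R ℓ n v w') :
    w = w' := by
  by_contra hne
  exact lt_asymm (h.2 w' h'.1 (Ne.symm hne)) (h'.2 w h.1 hne)

/-- Strict minimality gives uniqueness at both ends for any labels; injectivity matters only for the
existence of minimisers. -/
theorem isAugmentingMatching_selects : G.IsAugmentingMatching R n (G.Selects R ℓ n) where
  augments h := h.1.1
  left h h' := h.1.unique h'.1
  right {v v' w} h h' := by
    by_contra hne
    exact lt_asymm (h.2 v' h'.1 (Ne.symm hne)) (h'.2 v h.1 hne)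

theorem _root_.Set.Finite.exists_forall_ne_lt {α : Type*} {s : Set α} (hs : s.Finite)
    (hne : s.Nonempty) {ℓ : α → ℝ} (hℓ : Function.Injective ℓ) :
    ∃ a ∈ s, ∀ b ∈ s, b ≠ a → ℓ a < ℓ b := by
  obtain ⟨a, ha, hmin⟩ := Set.exists_min_image s ℓ hs hne
  exact ⟨a, ha, fun b hb hba => lt_of_le_of_ne (hmin b hb) fun h => hba (hℓ h).symm⟩

theorem Connected.finite_augments [G.LocallyFinite] (h : G.Connected) (v : V) :
    {w | G.Augments R n w v}.Finite :=
  (h.finite_setOf_dist_le v n).subset fun w hw => by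
    show G.dist v w ≤ n
    rw [dist_comm]
    exact hw.1

theorem Connected.exists_requests [G.LocallyFinite] (h : G.Connected)
    (hℓ : Function.Injective ℓ) {v : V} (hv : ∃ w, G.Augments R n w v) :
    ∃ w, G.Requests R ℓ n v w := by
  obtain ⟨w, hw, hmin⟩ := (h.finite_augments (R := R) (n := n) v).exists_forall_ne_lt hv hℓ
  exact ⟨w, hw, hmin⟩

theorem Connected.exists_selects [G.LocallyFinite] (h : G.Connected)
    (hℓ : Function.Injective ℓ) {w : V} (hw : ∃ v, G.Requests R ℓ n v w) :
    ∃ v, G.Selects R ℓ n v w := by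
  have hfin : {v | G.Requests R ℓ n v w}.Finite :=
    (h.finite_setOf_dist_le w n).subset fun v hv => hv.1.1
  obtain ⟨v, hv, hmin⟩ := hfin.exists_forall_ne_lt hw hℓ
  exact ⟨v, hv, hmin⟩

end SimpleGraph

namespace SimpleGraph

open ProbabilityTheory

variable {V : Type*} {G : SimpleGraph V}

/-! ### Equivariance of the construction -/

section Equivariance

variable {R R' : V → V → Prop} {ℓ ℓ' : V → ℝ} (γ : G ≃g G)

theorem onGeodesic_iso (w v x y : V) :
    G.OnGeodesic (γ w) (γ v) (γ x) (γ y) ↔ G.OnGeodesic w v x y := by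
  simp only [OnGeodesic, γ.dist_eq]

theorem augments_iso (hR : ∀ x y, R' (γ x) (γ y) ↔ R x y) (n : ℕ) (w v : V) :
    G.Augments R' n (γ w) (γ v) ↔ G.Augments R n w v := by
  symm
  unfold Augments Channel
  refine and_congr (by rw [γ.dist_eq]) (and_congr ?_ (and_congr ?_ ?_))
  · exact γ.toEquiv.forall_congr fun y => not_congr (hR v y).symm
  · refine γ.toEquiv.exists_congr fun y => γ.toEquiv.exists_congr fun z => ?_
    exact and_congr (not_congr γ.injective.eq_iff.symm) (and_congr (hR w y).symm (hR w z).symm)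
  · refine γ.toEquiv.forall_congr fun x => γ.toEquiv.forall_congr fun z => ?_
    refine imp_congr γ.map_adj_iff.symm (imp_congr (onGeodesic_iso γ _ _ _ _).symm ?_)
    refine and_congr (hR x z).symm (imp_congr (not_congr γ.injective.eq_iff.symm) ?_)
    exact γ.toEquiv.forall_congr fun z' => imp_congr (hR x z').symm γ.injective.eq_iff.symm

theorem requests_iso (hR : ∀ x y, R' (γ x) (γ y) ↔ R x y) (hℓ : ∀ x, ℓ' (γ x) = ℓ x) (n : ℕ)
    (v w : V) : G.Requests R' ℓ' n (γ v) (γ w) ↔ G.Requests R ℓ n v w := by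
  symm
  unfold Requests
  refine and_congr (augments_iso γ hR _ _ _).symm (γ.toEquiv.forall_congr fun w' => ?_)
  refine imp_congr (augments_iso γ hR _ _ _).symm
    (imp_congr (not_congr γ.injective.eq_iff.symm) ?_)
  rw [hℓ w]
  exact Iff.of_eq (congrArg _ (hℓ w').symm)

theorem selects_iso (hR : ∀ x y, R' (γ x) (γ y) ↔ R x y) (hℓ : ∀ x, ℓ' (γ x) = ℓ x) (n : ℕ)
    (v w : V) : G.Selects R' ℓ' n (γ v) (γ w) ↔ G.Selects R ℓ n v w := by
  symm
  unfold Selects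
  refine and_congr (requests_iso γ hR hℓ _ _ _).symm (γ.toEquiv.forall_congr fun v' => ?_)
  refine imp_congr (requests_iso γ hR hℓ _ _ _).symm
    (imp_congr (not_congr γ.injective.eq_iff.symm) ?_)
  rw [hℓ v]
  exact Iff.of_eq (congrArg _ (hℓ v').symm)

theorem reverseAlong_iso {M M' : V → V → Prop} (hR : ∀ x y, R' (γ x) (γ y) ↔ R x y)
    (hM : ∀ x y, M' (γ x) (γ y) ↔ M x y) (x y : V) :
    G.reverseAlong R' M' (γ x) (γ y) ↔ G.reverseAlong R M x y := by
  have h : G.OnSome M' (γ x) (γ y) ↔ G.OnSome M x y := by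
    symm
    refine γ.toEquiv.exists_congr fun v => γ.toEquiv.exists_congr fun w => ?_
    exact and_congr (hM v w).symm
      (or_congr (onGeodesic_iso γ _ _ _ _).symm (onGeodesic_iso γ _ _ _ _).symm)
  simp only [reverseAlong, h, hR]

end Equivariance

/-! ### Measurability of the construction -/

section Measurability

variable {Ω : Type*} [MeasurableSpace Ω] [Countable V] {R : Ω → V → V → Prop} {ℓ : Ω → V → ℝ}

theorem measurable_augments (hR : ∀ x y, Measurable fun ω => R ω x y) (n : ℕ) (w v : V) :
    Measurable fun ω => G.Augments (R ω) n w v := by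
  unfold Augments Channel
  refine measurable_const.and (.and (.forall fun y => (hR v y).not) (.and ?_ ?_))
  · exact .exists fun y => .exists fun z => measurable_const.and ((hR w y).and (hR w z))
  · refine .forall fun x => .forall fun z => measurable_const.imp (measurable_const.imp ?_)
    exact (hR x z).and
      (measurable_const.imp (.forall fun z' => (hR x z').imp measurable_const))

theorem measurable_requests (hR : ∀ x y, Measurable fun ω => R ω x y)
    (hℓ : ∀ x, Measurable fun ω => ℓ ω x) (n : ℕ) (v w : V) :
    Measurable fun ω => G.Requests (R ω) (ℓ ω) n v w := by
  refine (measurable_augments hR n w v).and (.forall fun w' => ?_)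
  refine (measurable_augments hR n w' v).imp (measurable_const.imp ?_)
  exact measurableSet_setOfPred.1 (measurableSet_lt (hℓ w) (hℓ w'))

theorem measurable_selects (hR : ∀ x y, Measurable fun ω => R ω x y)
    (hℓ : ∀ x, Measurable fun ω => ℓ ω x) (n : ℕ) (v w : V) :
    Measurable fun ω => G.Selects (R ω) (ℓ ω) n v w := by
  refine (measurable_requests hR hℓ n v w).and (.forall fun v' => ?_)
  refine (measurable_requests hR hℓ n v' w).imp (measurable_const.imp ?_)
  exact measurableSet_setOfPred.1 (measurableSet_lt (hℓ v) (hℓ v'))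

theorem measurable_reverseAlong {M : Ω → V → V → Prop} (hR : ∀ x y, Measurable fun ω => R ω x y)
    (hM : ∀ x y, Measurable fun ω => M ω x y) (x y : V) :
    Measurable fun ω => G.reverseAlong (R ω) (M ω) x y := by
  have h : Measurable fun ω => G.OnSome (M ω) x y :=
    .exists fun v => .exists fun w => (hM v w).and measurable_const
  exact (h.and (hR y x)).or (h.not.and (hR x y))

end Measurability

/-! ### Vertex labels and the invariant law of edge labels -/

section Labels

open Classical in
/-- The sum of the labels of the edges at `x`. -/
noncomputable def vertexLabel (G : SimpleGraph V) (ω : G.edgeSet → unitInterval) (x : V) : ℝ :=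
  ∑ᶠ e : G.edgeSet, if x ∈ e.1 then (ω e : ℝ) else 0

theorem vertexLabel_actLabelling (γ : G ≃g G) (ω : G.edgeSet → unitInterval) (x : V) :
    G.vertexLabel (actLabelling γ ω) (γ x) = G.vertexLabel ω x := by
  classical
  unfold vertexLabel
  rw [← finsum_comp_equiv γ.mapEdgeSet]
  refine finsum_congr fun e => ?_
  have h1 : γ x ∈ (γ.mapEdgeSet e).1 ↔ x ∈ e.1 := by
    change γ x ∈ Sym2.map γ e.1 ↔ _
    rw [Sym2.mem_map]
    exact ⟨fun ⟨a, ha, hax⟩ => γ.injective hax ▸ ha, fun h => ⟨x, h, rfl⟩⟩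
  have h2 : actLabelling γ ω (γ.mapEdgeSet e) = ω e :=
    congrArg ω (γ.mapEdgeSet.symm_apply_apply e)
  simp only [h1, h2]

theorem finite_setOf_mem_edge [G.LocallyFinite] (x : V) : {e : G.edgeSet | x ∈ e.1}.Finite := by
  classical
  refine Set.Finite.of_finite_image (f := Subtype.val)
    ((G.incidenceSet x).toFinite.subset ?_) Subtype.val_injective.injOn
  rintro _ ⟨e, he, rfl⟩
  exact ⟨e.2, he⟩

open Classical in
theorem vertexLabel_eq_sum (ω : G.edgeSet → unitInterval) {x : V} {T : Finset G.edgeSet}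
    (hT : ∀ e : G.edgeSet, x ∈ e.1 → e ∈ T) :
    G.vertexLabel ω x = ∑ e ∈ T, if x ∈ e.1 then (ω e : ℝ) else 0 :=
  finsum_eq_sum_of_support_subset _ fun e he => hT e <| by
    by_contra h
    simp [h] at he

theorem measurable_vertexLabel [G.LocallyFinite] (x : V) :
    Measurable fun ω => G.vertexLabel ω x := by
  classical
  have : ∀ ω, G.vertexLabel ω x = ∑ e ∈ (G.finite_setOf_mem_edge x).toFinset,
      if x ∈ e.1 then (ω e : ℝ) else 0 := fun ω =>
    vertexLabel_eq_sum ω fun e he => by simpa using he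
  simp only [this]
  refine Finset.measurable_sum _ fun e _ => ?_
  split_ifs
  · exact measurable_subtype_coe.comp (measurable_pi_apply e)
  · exact measurable_const

instance : IsProbabilityMeasure (edgeLabelLaw G) := by
  unfold edgeLabelLaw
  infer_instance

/-- By Fubini: once `Y` is fixed, `X` would have to hit a single value, and `X` has no atoms. -/
theorem ae_add_ne_zero_of_indepFun {Ω : Type*} [MeasurableSpace Ω] {μ : Measure Ω}
    [IsProbabilityMeasure μ] {X Y : Ω → ℝ} (hX : Measurable X) (hY : Measurable Y)
    (h : IndepFun X Y μ) (h0 : ∀ r, μ (X ⁻¹' {r}) = 0) : ∀ᵐ ω ∂μ, X ω + Y ω ≠ 0 := by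
  have hs : MeasurableSet {p : ℝ × ℝ | p.1 + p.2 = 0} :=
    measurableSet_eq_fun (by fun_prop) measurable_const
  have h1 : (μ.map fun ω => (Y ω, X ω)) {p : ℝ × ℝ | p.1 + p.2 = 0} = 0 := by
    rw [(indepFun_iff_map_prod_eq_prod_map_map hY.aemeasurable hX.aemeasurable).1 h.symm,
      Measure.measure_prod_null hs]
    refine Filter.Eventually.of_forall fun y => ?_
    have : Prod.mk y ⁻¹' {p : ℝ × ℝ | p.1 + p.2 = 0} = {-y} := by
      ext r
      simp only [Set.mem_preimage, Set.mem_ofPred_eq, Set.mem_singleton_iff]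
      constructor <;> intro h <;> linarith
    change (μ.map X) (Prod.mk y ⁻¹' {p : ℝ × ℝ | p.1 + p.2 = 0}) = 0
    rw [this, Measure.map_apply hX (measurableSet_singleton _)]
    exact h0 _
  rw [Measure.map_apply (hY.prodMk hX) hs] at h1
  rw [ae_iff]
  refine measure_mono_null (fun ω hω => ?_) h1
  simp only [not_not, Set.mem_ofPred_eq, Set.mem_preimage] at hω ⊢
  linarith

theorem ae_injective_vertexLabel [G.LocallyFinite] [Countable V]
    (hdeg : ∀ x y : V, ∃ y', G.Adj x y' ∧ y' ≠ y) :
    ∀ᵐ ω ∂(edgeLabelLaw G), Function.Injective (G.vertexLabel ω) := by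
  classical
  have key : ∀ x x' : V, x ≠ x' →
      ∀ᵐ ω ∂(edgeLabelLaw G), G.vertexLabel ω x ≠ G.vertexLabel ω x' := by
    intro x x' hne
    -- The edge from `x` to some `y ≠ x'` counts for `x` but not for `x'`; its label is atomless and
    -- independent of the rest of the difference of the two sums.
    obtain ⟨y, hxy, hy⟩ := hdeg x x'
    set e₀ : G.edgeSet := ⟨s(x, y), hxy⟩
    set T : Finset G.edgeSet :=
      (G.finite_setOf_mem_edge x).toFinset ∪ (G.finite_setOf_mem_edge x').toFinset
    set f : G.edgeSet → (G.edgeSet → unitInterval) → ℝ := fun e ω =>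
      (if x ∈ e.1 then (ω e : ℝ) else 0) - if x' ∈ e.1 then (ω e : ℝ) else 0 with hf
    have hg : ∀ e : G.edgeSet, Measurable fun u : unitInterval =>
        (if x ∈ e.1 then (u : ℝ) else 0) - if x' ∈ e.1 then (u : ℝ) else 0 := by
      intro e
      split_ifs <;> fun_prop
    have hfm : ∀ e, Measurable (f e) := fun e => (hg e).comp (measurable_pi_apply e)
    have hind : iIndepFun f (edgeLabelLaw G) := iIndepFun_infinitePi hg
    have hsum : ∀ ω, G.vertexLabel ω x - G.vertexLabel ω x' =
        f e₀ ω + (∑ e ∈ T.erase e₀, f e) ω := by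
      intro ω
      rw [vertexLabel_eq_sum ω (T := T) (fun e he => by simp [T, he]),
        vertexLabel_eq_sum ω (T := T) (x := x') (fun e he => by simp [T, he]),
        ← Finset.sum_sub_distrib, Finset.sum_apply]
      refine (Finset.add_sum_erase T (fun e => f e ω) ?_).symm
      simp [T, e₀]
    have hf₀ : ∀ ω, f e₀ ω = ω e₀ := by
      intro ω
      have h1 : x ∈ e₀.1 := Sym2.mem_mk_left x y
      have h2 : x' ∉ e₀.1 := by
        intro h
        rcases Sym2.mem_iff.1 h with h | h
        · exact hne h.symm
        · exact hy h.symm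
      simp [hf, h1, h2]
    have h0 : ∀ r, edgeLabelLaw G (f e₀ ⁻¹' {r}) = 0 := by
      intro r
      have hpre : f e₀ ⁻¹' {r} = Function.eval e₀ ⁻¹' (Subtype.val ⁻¹' {r}) := by
        ext ω
        simp [hf₀]
      have hms : MeasurableSet ((Subtype.val : unitInterval → ℝ) ⁻¹' {r}) :=
        measurable_subtype_coe (measurableSet_singleton r)
      rw [hpre]
      unfold edgeLabelLaw
      rw [(measurePreserving_eval_infinitePi (fun _ : G.edgeSet => (volume : Measure unitInterval))
        e₀).measure_preimage hms.nullMeasurableSet]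
      exact Set.Subsingleton.measure_zero
        ((Set.subsingleton_singleton).preimage Subtype.val_injective) _
    have hYm : Measurable (∑ e ∈ T.erase e₀, f e) := by
      rw [Finset.sum_fn]
      exact Finset.measurable_sum _ fun e _ => hfm e
    filter_upwards [ae_add_ne_zero_of_indepFun (hfm e₀) hYm
      (hind.indepFun_finsetSum_of_notMem hfm (Finset.notMem_erase e₀ T)).symm h0] with ω hω
    rw [← hsum] at hω
    exact sub_ne_zero.1 hω
  have := ae_all_iff.2 fun x => ae_all_iff.2 fun x' => ae_all_iff.2 (key x x')
  filter_upwards [this] with ω hω x x' h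
  by_contra hne
  exact hω x x' hne h

theorem measurePreserving_actLabelling (γ : G ≃g G) :
    MeasurePreserving (actLabelling γ) (edgeLabelLaw G) (edgeLabelLaw G) := by
  refine ⟨measurable_pi_lambda _ fun e => measurable_pi_apply _, ?_⟩
  have h := Measure.infinitePi_map_piCongrLeft
    (fun _ : G.edgeSet => (volume : Measure unitInterval)) γ.mapEdgeSet
  have h2 : actLabelling γ =
      MeasurableEquiv.piCongrLeft (fun _ : G.edgeSet => unitInterval) γ.mapEdgeSet := by
    funext ω e
    obtain ⟨e, rfl⟩ := γ.mapEdgeSet.surjective e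
    rw [MeasurableEquiv.piCongrLeft_apply_apply]
    exact congrArg ω (γ.mapEdgeSet.symm_apply_apply e)
  rw [h2]
  exact h

end Labels

end SimpleGraph

namespace SimpleGraph

open Filter
open scoped ENNReal

variable {V : Type*} {G : SimpleGraph V}

/-- A random relation between vertices that is an equivariant measurable function of the labels. -/
structure IsFactorRelation (Φ : (G.edgeSet → unitInterval) → V → V → Prop) : Prop where
  measurable : ∀ x y, Measurable fun ω => Φ ω x y
  equivariant : ∀ (γ : G ≃g G) ω x y, Φ (actLabelling γ ω) (γ x) (γ y) ↔ Φ ω x y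

/-! ### Mass transport -/

section MassTransport

variable [G.LocallyFinite] {d : ℕ}

/-- The sums agree term by term, because an automorphism exchanging `x` and `y` preserves the law.
-/
theorem IsTree.mass_transport (hG : G.IsTree) (hreg : G.IsRegularOfDegree d)
    {Φ : (G.edgeSet → unitInterval) → V → V → Prop} (hΦ : IsFactorRelation Φ) (x : V) :
    ∑' y, edgeLabelLaw G {ω | Φ ω x y} = ∑' y, edgeLabelLaw G {ω | Φ ω y x} := by
  refine tsum_congr fun y => ?_
  obtain ⟨γ, hx, hy⟩ := hG.exists_iso_swap hreg x y
  have h := (measurePreserving_actLabelling γ).measure_preimage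
    (measurableSet_setOfPred.2 (hΦ.measurable y x)).nullMeasurableSet
  rw [← h]
  congr 1
  ext ω
  have := hΦ.equivariant γ ω x y
  rw [hx, hy] at this
  exact this.symm

/-- The sum is the expected number of indices that occur, which is at most `k` and vanishes off the
event that one occurs. -/
theorem tsum_measure_le_mul {Ω ι : Type*} [MeasurableSpace Ω] [Countable ι] {μ : Measure Ω}
    {p : Ω → ι → Prop} (hp : ∀ i, Measurable fun ω => p ω i) {k : ℕ}
    (hk : ∀ᵐ ω ∂μ, ∀ S : Finset ι, (∀ i ∈ S, p ω i) → S.card ≤ k) :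
    ∑' i, μ {ω | p ω i} ≤ k * μ {ω | ∃ i, p ω i} := by
  classical
  refine ENNReal.summable.tsum_le_of_sum_le fun S => ?_
  have hmeas : ∀ i, MeasurableSet {ω | p ω i} := fun i => measurableSet_setOfPred.2 (hp i)
  have hex : MeasurableSet {ω | ∃ i, p ω i} := measurableSet_setOfPred.2 (.exists hp)
  calc ∑ i ∈ S, μ {ω | p ω i} = ∑ i ∈ S, ∫⁻ ω, {ω | p ω i}.indicator 1 ω ∂μ :=
        Finset.sum_congr rfl fun i _ => (lintegral_indicator_one (hmeas i)).symm
    _ = ∫⁻ ω, ∑ i ∈ S, {ω | p ω i}.indicator 1 ω ∂μ :=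
        (lintegral_finsetSum _ fun i _ => measurable_one.indicator (hmeas i)).symm
    _ ≤ ∫⁻ ω, k * {ω | ∃ i, p ω i}.indicator 1 ω ∂μ := by
        refine lintegral_mono_ae ?_
        filter_upwards [hk] with ω hω
        have h1 : ∑ i ∈ S, {ω | p ω i}.indicator (1 : Ω → ℝ≥0∞) ω =
            ((S.filter fun i => p ω i).card : ℝ≥0∞) := by
          simp [Set.indicator_apply, Finset.sum_boole]
        rw [h1]
        by_cases hne : ∃ i, p ω i
        · have h2 : (S.filter fun i => p ω i).card ≤ k := hω _ (by simp)
          simpa [Set.indicator_apply, hne] using h2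
        · push Not at hne
          simp [hne]
    _ = k * μ {ω | ∃ i, p ω i} := by
        rw [lintegral_const_mul _ (measurable_one.indicator hex), lintegral_indicator_one hex]

theorem measure_exists_le_tsum {Ω ι : Type*} [MeasurableSpace Ω] [Countable ι] {μ : Measure Ω}
    (p : Ω → ι → Prop) : μ {ω | ∃ i, p ω i} ≤ ∑' i, μ {ω | p ω i} := by
  have : {ω | ∃ i, p ω i} = ⋃ i, {ω | p ω i} := by
    ext ω
    simp
  rw [this]
  exact measure_iUnion_le _

end MassTransport

/-! ### One round of sink removal -/

section Round

variable {Φ : (G.edgeSet → unitInterval) → V → V → Prop}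

theorem IsFactorRelation.selects [G.LocallyFinite] [Countable V] (hΦ : IsFactorRelation Φ)
    (n : ℕ) : IsFactorRelation fun ω => G.Selects (Φ ω) (G.vertexLabel ω) n where
  measurable := measurable_selects hΦ.measurable measurable_vertexLabel n
  equivariant γ ω := selects_iso γ (hΦ.equivariant γ ω) (vertexLabel_actLabelling γ ω) n

theorem IsFactorRelation.requests [G.LocallyFinite] [Countable V] (hΦ : IsFactorRelation Φ)
    (n : ℕ) : IsFactorRelation fun ω => G.Requests (Φ ω) (G.vertexLabel ω) n where
  measurable := measurable_requests hΦ.measurable measurable_vertexLabel n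
  equivariant γ ω := requests_iso γ (hΦ.equivariant γ ω) (vertexLabel_actLabelling γ ω) n

theorem IsFactorRelation.swap (hΦ : IsFactorRelation Φ) :
    IsFactorRelation fun ω x y => Φ ω y x where
  measurable x y := hΦ.measurable y x
  equivariant γ ω x y := hΦ.equivariant γ ω y x

theorem IsFactorRelation.reverseAlong [Countable V] (hΦ : IsFactorRelation Φ)
    {M : (G.edgeSet → unitInterval) → V → V → Prop} (hM : IsFactorRelation M) :
    IsFactorRelation fun ω => G.reverseAlong (Φ ω) (M ω) where
  measurable := measurable_reverseAlong hΦ.measurable hM.measurable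
  equivariant γ ω := reverseAlong_iso γ (hΦ.equivariant γ ω) (hM.equivariant γ ω)

variable [G.LocallyFinite] {d : ℕ}

/-- A positive proportion of the sinks with an augmenting geodesic is selected. -/
theorem IsTree.measure_exists_augments_le [Countable V] (hG : G.IsTree)
    (hreg : G.IsRegularOfDegree d) (hΦ : IsFactorRelation Φ)
    (hℓ : ∀ᵐ ω ∂(edgeLabelLaw G), Function.Injective (G.vertexLabel ω)) (n : ℕ) (x : V) :
    edgeLabelLaw G {ω | ∃ w, G.Augments (Φ ω) n w x} ≤
      d * edgeLabelLaw G {ω | ∃ w, G.Selects (Φ ω) (G.vertexLabel ω) n x w} := by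
  -- Requests are transported to the requested starts, at the cost of a factor `d`; selections are
  -- transported back to the sinks at no cost.
  calc edgeLabelLaw G {ω | ∃ w, G.Augments (Φ ω) n w x}
      ≤ edgeLabelLaw G {ω | ∃ w, G.Requests (Φ ω) (G.vertexLabel ω) n x w} := by
        refine measure_mono_ae ?_
        filter_upwards [hℓ] with ω hω h
        exact hG.1.exists_requests hω h
    _ ≤ ∑' w, edgeLabelLaw G {ω | G.Requests (Φ ω) (G.vertexLabel ω) n x w} :=
        measure_exists_le_tsum _
    _ = ∑' v, edgeLabelLaw G {ω | G.Requests (Φ ω) (G.vertexLabel ω) n v x} :=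
        hG.mass_transport hreg (hΦ.requests n) x
    _ ≤ d * edgeLabelLaw G {ω | ∃ v, G.Requests (Φ ω) (G.vertexLabel ω) n v x} := by
        refine tsum_measure_le_mul (fun v => (hΦ.requests n).measurable v x)
          (.of_forall fun ω S hS => ?_)
        rw [← hreg x]
        exact hG.1.card_le_of_augments S fun v hv => (hS v hv).1
    _ ≤ d * edgeLabelLaw G {ω | ∃ v, G.Selects (Φ ω) (G.vertexLabel ω) n v x} := by
        refine mul_le_mul_right (measure_mono_ae ?_) _
        filter_upwards [hℓ] with ω hω h
        exact hG.1.exists_selects hω h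
    _ ≤ d * ∑' v, edgeLabelLaw G {ω | G.Selects (Φ ω) (G.vertexLabel ω) n v x} :=
        mul_le_mul_right (measure_exists_le_tsum _) _
    _ = d * ∑' w, edgeLabelLaw G {ω | G.Selects (Φ ω) (G.vertexLabel ω) n x w} := by
        rw [hG.mass_transport hreg (hΦ.selects n) x]
    _ ≤ d * ((1 : ℕ) * edgeLabelLaw G {ω | ∃ w, G.Selects (Φ ω) (G.vertexLabel ω) n x w}) := by
        refine mul_le_mul_right (tsum_measure_le_mul
          (fun w => (hΦ.selects n).measurable x w) (.of_forall fun ω S hS => ?_)) _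
        exact Finset.card_le_one.2 fun w hw w' hw' => (hS w hw).1.unique (hS w' hw').1
    _ = _ := by rw [Nat.cast_one, one_mul]

/-- Few sinks have no augmenting geodesic of length at most `n`. -/
theorem IsTree.measure_forall_not_augments_le [Countable V] (hG : G.IsTree) (hd : 3 ≤ d)
    (hreg : G.IsRegularOfDegree d) (hΦ : IsFactorRelation Φ)
    (hor : ∀ᵐ ω ∂(edgeLabelLaw G), G.Orients (Φ ω)) (n : ℕ) (x : V) :
    2 ^ n * edgeLabelLaw G {ω | (∀ y, ¬ Φ ω x y) ∧ ∀ w, ¬ G.Augments (Φ ω) n w x} ≤ 1 := by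
  -- Each bad sink sends unit mass to every vertex at distance exactly `n`: at least `2 ^ n` is
  -- sent, and at most one unit is received, since a vertex flows into only one sink.
  set T : (G.edgeSet → unitInterval) → V → V → Prop := fun ω x y =>
    ((∀ y, ¬ Φ ω x y) ∧ ∀ w, ¬ G.Augments (Φ ω) n w x) ∧ G.dist x y = n with hT
  have hTf : IsFactorRelation T := by
    constructor
    · intro x y
      refine ((Measurable.forall fun y => (hΦ.measurable x y).not).and
        (.forall fun w => (measurable_augments hΦ.measurable n w x).not)).and measurable_const
    · intro γ ω x y
      refine (and_congr (and_congr ?_ ?_) (by rw [γ.dist_eq])).symm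
      · exact γ.toEquiv.forall_congr fun y => not_congr (hΦ.equivariant γ ω x y).symm
      · exact γ.toEquiv.forall_congr fun w =>
          not_congr (augments_iso γ (hΦ.equivariant γ ω) n w x).symm
  obtain ⟨S, hS, hcard⟩ := hG.exists_finset_dist_eq hd hreg x n
  set q := edgeLabelLaw G {ω | (∀ y, ¬ Φ ω x y) ∧ ∀ w, ¬ G.Augments (Φ ω) n w x}
  calc 2 ^ n * q ≤ S.card * q := mul_le_mul_left (by exact_mod_cast hcard) _
    _ = ∑ y ∈ S, edgeLabelLaw G {ω | T ω x y} := by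
        rw [← nsmul_eq_mul, ← Finset.sum_const]
        refine Finset.sum_congr rfl fun y hy => ?_
        simp only [hT, hS y hy, and_true, q]
    _ ≤ ∑' y, edgeLabelLaw G {ω | T ω x y} := ENNReal.sum_le_tsum S
    _ = ∑' y, edgeLabelLaw G {ω | T ω y x} := hG.mass_transport hreg hTf x
    _ ≤ (1 : ℕ) * edgeLabelLaw G {ω | ∃ y, T ω y x} := by
        refine tsum_measure_le_mul (fun y => hTf.measurable y x) ?_
        filter_upwards [hor] with ω hω S hS
        refine Finset.card_le_one.2 fun v hv v' hv' => ?_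
        obtain ⟨⟨h1, h2⟩, h3⟩ := hS v hv
        obtain ⟨⟨h1', h2'⟩, h3'⟩ := hS v' hv'
        exact hG.1.flowsTo_unique h1 h1'
          (hG.flowsTo_of_forall_not_augments hω h1 h2 h3.le)
          (hG.flowsTo_of_forall_not_augments hω h1' h2' h3'.le)
    _ ≤ 1 := by
        rw [Nat.cast_one, one_mul]
        exact prob_le_one

/-- A vertex is rarely on a geodesic that is reversed. -/
theorem IsTree.measure_between_selects_le [Countable V] (hG : G.IsTree)
    (hreg : G.IsRegularOfDegree d) (hΦ : IsFactorRelation Φ) (n : ℕ) (x : V) :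
    edgeLabelLaw G {ω | ∃ v w, G.Selects (Φ ω) (G.vertexLabel ω) n v w ∧
        G.dist w x + G.dist x v = G.dist w v} ≤
      (n + 1 : ℕ) * edgeLabelLaw G {ω | ∀ y, ¬ Φ ω x y} := by
  -- Each selected sink sends unit mass to the at most `n + 1` vertices of its geodesic.
  set T : (G.edgeSet → unitInterval) → V → V → Prop := fun ω v x =>
    ∃ w, G.Selects (Φ ω) (G.vertexLabel ω) n v w ∧ G.dist w x + G.dist x v = G.dist w v with hT
  have hTf : IsFactorRelation T := by
    constructor
    · intro v x
      exact .exists fun w => ((hΦ.selects n).measurable v w).and measurable_const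
    · intro γ ω v x
      refine (γ.toEquiv.exists_congr fun w => ?_).symm
      refine and_congr ((hΦ.selects n).equivariant γ ω v w).symm (Iff.of_eq ?_)
      rw [← γ.dist_eq w x, ← γ.dist_eq x v, ← γ.dist_eq w v]
      rfl
  calc edgeLabelLaw G {ω | ∃ v, T ω v x}
      ≤ ∑' v, edgeLabelLaw G {ω | T ω v x} := measure_exists_le_tsum _
    _ = ∑' v, edgeLabelLaw G {ω | T ω x v} := (hG.mass_transport hreg hTf x).symm
    _ ≤ (n + 1 : ℕ) * edgeLabelLaw G {ω | ∃ v, T ω x v} := by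
        refine tsum_measure_le_mul (fun v => hTf.measurable x v) (.of_forall fun ω S hS => ?_)
        rcases S.eq_empty_or_nonempty with rfl | ⟨y, hy⟩
        · simp
        obtain ⟨w, hw, -⟩ := hS y hy
        refine hG.card_between_le hw.1.1.1 S fun v hv => ?_
        obtain ⟨w', hw', h⟩ := hS v hv
        rwa [hw.1.unique hw'.1]
    _ ≤ _ := by
        refine mul_le_mul_right (measure_mono ?_) _
        rintro ω ⟨v, w, hw, -⟩
        exact hw.1.1.2.1

/-- The selected sinks are no longer sinks, and no sinks are created. -/
theorem IsTree.measure_sink_reverseAlong_add_le [Countable V] (hG : G.IsTree)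
    (hΦ : IsFactorRelation Φ) (hor : ∀ᵐ ω ∂(edgeLabelLaw G), G.Orients (Φ ω)) (n : ℕ) (x : V) :
    edgeLabelLaw G {ω | ∀ y,
        ¬ G.reverseAlong (Φ ω) (G.Selects (Φ ω) (G.vertexLabel ω) n) x y} +
      edgeLabelLaw G {ω | ∃ w, G.Selects (Φ ω) (G.vertexLabel ω) n x w} ≤
      edgeLabelLaw G {ω | ∀ y, ¬ Φ ω x y} := by
  have hm : MeasurableSet {ω | ∃ w, G.Selects (Φ ω) (G.vertexLabel ω) n x w} :=
    measurableSet_setOfPred.2 (.exists fun w => (hΦ.selects n).measurable x w)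
  rw [← measure_inter_add_sdiff {ω | ∀ y, ¬ Φ ω x y} hm, add_comm]
  refine add_le_add (measure_mono ?_) (measure_mono_ae ?_)
  · rintro ω ⟨w, hw⟩
    exact ⟨hw.1.1.2.1, w, hw⟩
  · filter_upwards [hor] with ω hω h
    refine ⟨?_, ?_⟩
    · by_contra hcon
      obtain ⟨y, hy⟩ := not_forall_not.1 hcon
      obtain ⟨y', hy'⟩ := isAugmentingMatching_selects.not_sink hω hG ⟨y, hy⟩
      exact h y' hy'
    · rintro ⟨w, hw⟩
      obtain ⟨y, hy⟩ := isAugmentingMatching_selects.not_sink_of_mem hG hw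
      exact h y hy

/-- The recursion for the density of sinks. -/
theorem IsTree.measureReal_sink_reverseAlong_le [Countable V] (hG : G.IsTree) (hd : 3 ≤ d)
    (hreg : G.IsRegularOfDegree d) (hΦ : IsFactorRelation Φ)
    (hor : ∀ᵐ ω ∂(edgeLabelLaw G), G.Orients (Φ ω))
    (hℓ : ∀ᵐ ω ∂(edgeLabelLaw G), Function.Injective (G.vertexLabel ω)) (n : ℕ) (x : V) :
    (edgeLabelLaw G).real {ω | ∀ y,
        ¬ G.reverseAlong (Φ ω) (G.Selects (Φ ω) (G.vertexLabel ω) n) x y} ≤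
      (1 - 1 / d) * (edgeLabelLaw G).real {ω | ∀ y, ¬ Φ ω x y} + 1 / d * (1 / 2) ^ n := by
  have h1 := ENNReal.toReal_mono (by finiteness) (hG.measure_exists_augments_le hreg hΦ hℓ n x)
  have h2 := ENNReal.toReal_mono (by finiteness)
    (hG.measure_forall_not_augments_le hd hreg hΦ hor n x)
  have h3 := ENNReal.toReal_mono (by finiteness)
    (hG.measure_sink_reverseAlong_add_le hΦ hor n x)
  rw [ENNReal.toReal_add (by finiteness) (by finiteness)] at h3
  simp only [ENNReal.toReal_mul, ENNReal.toReal_natCast, ENNReal.toReal_pow, ENNReal.toReal_ofNat,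
    ENNReal.toReal_one, ← measureReal_def] at h1 h2 h3
  have h4 : (edgeLabelLaw G).real {ω | ∀ y, ¬ Φ ω x y} ≤
      (edgeLabelLaw G).real {ω | ∃ w, G.Augments (Φ ω) n w x} +
      (edgeLabelLaw G).real {ω | (∀ y, ¬ Φ ω x y) ∧ ∀ w, ¬ G.Augments (Φ ω) n w x} := by
    refine (measureReal_mono ?_).trans (measureReal_union_le _ _)
    intro ω hω
    by_cases h : ∃ w, G.Augments (Φ ω) n w x
    · exact Or.inl h
    · exact Or.inr ⟨hω, not_exists.1 h⟩
  set s := (edgeLabelLaw G).real {ω | ∀ y, ¬ Φ ω x y}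
  set a := (edgeLabelLaw G).real {ω | ∃ w, G.Augments (Φ ω) n w x}
  set m := (edgeLabelLaw G).real {ω | ∃ w, G.Selects (Φ ω) (G.vertexLabel ω) n x w}
  set q := (edgeLabelLaw G).real {ω | (∀ y, ¬ Φ ω x y) ∧ ∀ w, ¬ G.Augments (Φ ω) n w x}
  have hd0 : (0 : ℝ) < d := by
    have : (3 : ℝ) ≤ d := by exact_mod_cast hd
    linarith
  have h5 : q ≤ (1 / 2) ^ n := by
    rw [one_div, inv_pow, ← one_div, le_div_iff₀ (by positivity), mul_comm]
    exact h2
  have h6 : 1 / d * a ≤ m := by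
    rw [one_div, inv_mul_le_iff₀ hd0]
    exact h1
  have h7 : 1 / d * s ≤ 1 / d * a + 1 / d * (1 / 2) ^ n := by
    rw [← mul_add]
    exact mul_le_mul_of_nonneg_left (by linarith) (by positivity)
  linarith

end Round

end SimpleGraph

/-! ### Iteration and passage to the limit -/

namespace SimpleGraph

open Filter
open scoped ENNReal

variable {V : Type*} {G : SimpleGraph V}

/-- The successive stages of the removal of sinks: at stage `n`, the selected augmenting geodesics
of length at most `n` are reversed. -/
def sinkRemoval (Φ : (G.edgeSet → unitInterval) → V → V → Prop) :
    ℕ → (G.edgeSet → unitInterval) → V → V → Prop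
  | 0 => Φ
  | n + 1 => fun ω => G.reverseAlong (sinkRemoval Φ n ω)
      (G.Selects (sinkRemoval Φ n ω) (G.vertexLabel ω) n)

variable [G.LocallyFinite] [Countable V] {d : ℕ}
  {Φ : (G.edgeSet → unitInterval) → V → V → Prop}

theorem IsFactorRelation.sinkRemoval (hΦ : IsFactorRelation Φ) (n : ℕ) :
    IsFactorRelation (sinkRemoval Φ n) := by
  induction n with
  | zero => exact hΦ
  | succ n ih => exact ih.reverseAlong (ih.selects n)

omit [G.LocallyFinite] [Countable V] in
theorem orients_sinkRemoval {ω : G.edgeSet → unitInterval} (h : G.Orients (Φ ω)) (n : ℕ) :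
    G.Orients (sinkRemoval Φ n ω) := by
  induction n with
  | zero => exact h
  | succ n ih => exact ih.reverseAlong

theorem IsTree.measureReal_sink_sinkRemoval_le (hG : G.IsTree) (hd : 3 ≤ d)
    (hreg : G.IsRegularOfDegree d) (hΦ : IsFactorRelation Φ)
    (hor : ∀ᵐ ω ∂(edgeLabelLaw G), G.Orients (Φ ω))
    (hℓ : ∀ᵐ ω ∂(edgeLabelLaw G), Function.Injective (G.vertexLabel ω)) (n : ℕ) (x : V) :
    (edgeLabelLaw G).real {ω | ∀ y, ¬ sinkRemoval Φ n ω x y} ≤ 3 * (1 - 1 / d) ^ n := by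
  have hd3 : (3 : ℝ) ≤ d := by exact_mod_cast hd
  have hd1 : (1 : ℝ) / d ≤ 1 / 3 := one_div_le_one_div_of_le (by norm_num) hd3
  -- The extra term absorbs the error of the recursion: the induction needs `1 / d + 1 ≤ 2 * (1 - 1
  -- / d)`, that is, `d ≥ 3`.
  suffices h : (edgeLabelLaw G).real {ω | ∀ y, ¬ sinkRemoval Φ n ω x y} + 2 * (1 / 2) ^ n ≤
      3 * (1 - 1 / d) ^ n by
    have : (0 : ℝ) ≤ 2 * (1 / 2) ^ n := by positivity
    linarith
  induction n with
  | zero =>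
    have : (edgeLabelLaw G).real {ω | ∀ y, ¬ sinkRemoval Φ 0 ω x y} ≤ 1 := measureReal_le_one
    simp only [pow_zero, mul_one]
    linarith
  | succ n ih =>
    have h := hG.measureReal_sink_reverseAlong_le hd hreg (hΦ.sinkRemoval n)
      (hor.mono fun ω hω => orients_sinkRemoval hω n) hℓ n x
    set s := (edgeLabelLaw G).real {ω | ∀ y, ¬ sinkRemoval Φ n ω x y}
    change (edgeLabelLaw G).real {ω | ∀ y, ¬ sinkRemoval Φ (n + 1) ω x y} ≤ _ at h
    have h2 := mul_le_mul_of_nonneg_left ih (show (0 : ℝ) ≤ 1 - 1 / d by linarith)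
    have h3 : (0 : ℝ) ≤ (1 - 3 * (1 / d)) * (1 / 2) ^ n :=
      mul_nonneg (by linarith) (by positivity)
    rw [pow_succ, pow_succ]
    linarith

/-- Borel–Cantelli, as `(n + 1) * 3 * (1 - 1 / d) ^ n` is summable. -/
theorem IsTree.ae_eventually_not_between_selects (hG : G.IsTree) (hd : 3 ≤ d)
    (hreg : G.IsRegularOfDegree d) (hΦ : IsFactorRelation Φ)
    (hor : ∀ᵐ ω ∂(edgeLabelLaw G), G.Orients (Φ ω))
    (hℓ : ∀ᵐ ω ∂(edgeLabelLaw G), Function.Injective (G.vertexLabel ω)) (x : V) :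
    ∀ᵐ ω ∂(edgeLabelLaw G), ∀ᶠ n in atTop, ∀ v w,
      G.Selects (sinkRemoval Φ n ω) (G.vertexLabel ω) n v w →
        G.dist w x + G.dist x v ≠ G.dist w v := by
  set q : ℝ := 1 - 1 / d with hq
  have hd3 : (3 : ℝ) ≤ d := by exact_mod_cast hd
  have hd1 : (1 : ℝ) / d ≤ 1 / 3 := one_div_le_one_div_of_le (by norm_num) hd3
  have hd0 : (0 : ℝ) < 1 / d := by positivity
  have hsum : Summable fun n : ℕ => ((n : ℝ) + 1) * (3 * q ^ n) := by
    have hq1 : ‖q‖ < 1 := by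
      rw [Real.norm_eq_abs, abs_lt]
      constructor <;> linarith
    have h1 := (summable_pow_mul_geometric_of_norm_lt_one 1 hq1).mul_left 3
    have h2 := (summable_geometric_of_norm_lt_one hq1).mul_left 3
    refine (h1.add h2).congr fun n => ?_
    ring
  have hle : ∀ n, edgeLabelLaw G {ω | ∃ v w,
      G.Selects (sinkRemoval Φ n ω) (G.vertexLabel ω) n v w ∧
        G.dist w x + G.dist x v = G.dist w v} ≤ ENNReal.ofReal (((n : ℝ) + 1) * (3 * q ^ n)) := by
    intro n
    refine (hG.measure_between_selects_le hreg (hΦ.sinkRemoval n) n x).trans ?_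
    rw [ENNReal.ofReal_mul (by positivity)]
    refine mul_le_mul' (le_of_eq ?_) ?_
    · rw [← Nat.cast_succ, ENNReal.ofReal_natCast]
    · rw [← ofReal_measureReal]
      exact ENNReal.ofReal_le_ofReal
        (hG.measureReal_sink_sinkRemoval_le hd hreg hΦ hor hℓ n x)
  have hfin := ne_top_of_le_ne_top hsum.tsum_ofReal_ne_top (ENNReal.tsum_le_tsum hle)
  filter_upwards [ae_eventually_notMem hfin] with ω hω
  filter_upwards [hω] with n hn v w hvw h
  exact hn ⟨v, w, hvw, h⟩

/-- Being a sink at every stage is at most as likely as being one at stage `n`, and that probability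
tends to zero. -/
theorem IsTree.ae_exists_not_sink (hG : G.IsTree) (hd : 3 ≤ d)
    (hreg : G.IsRegularOfDegree d) (hΦ : IsFactorRelation Φ)
    (hor : ∀ᵐ ω ∂(edgeLabelLaw G), G.Orients (Φ ω))
    (hℓ : ∀ᵐ ω ∂(edgeLabelLaw G), Function.Injective (G.vertexLabel ω)) (x : V) :
    ∀ᵐ ω ∂(edgeLabelLaw G), ∃ n y, sinkRemoval Φ n ω x y := by
  have hd3 : (3 : ℝ) ≤ d := by exact_mod_cast hd
  have hd1 : (1 : ℝ) / d ≤ 1 / 3 := one_div_le_one_div_of_le (by norm_num) hd3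
  have hd0 : (0 : ℝ) < 1 / d := by positivity
  have hle : ∀ n, (edgeLabelLaw G).real {ω | ¬ ∃ n y, sinkRemoval Φ n ω x y} ≤
      3 * (1 - 1 / d) ^ n := fun n => by
    refine (measureReal_mono fun ω hω y hy => ?_).trans
      (hG.measureReal_sink_sinkRemoval_le hd hreg hΦ hor hℓ n x)
    exact hω ⟨n, y, hy⟩
  have hlim : Tendsto (fun n : ℕ => 3 * (1 - 1 / (d : ℝ)) ^ n) atTop (nhds (3 * 0)) :=
    (tendsto_pow_atTop_nhds_zero_of_lt_one (by linarith) (by linarith)).const_mul 3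
  have h0 := ge_of_tendsto' hlim hle
  rw [mul_zero] at h0
  rw [ae_iff]
  exact (measureReal_eq_zero_iff (by finiteness)).1 (le_antisymm h0 measureReal_nonneg)

/-- Every factor orientation can be replaced by one without sinks that has no new sources. -/
theorem IsTree.exists_factor_sinkless (hG : G.IsTree) (hd : 3 ≤ d)
    (hreg : G.IsRegularOfDegree d) (hdeg : ∀ x y : V, ∃ y', G.Adj x y' ∧ y' ≠ y)
    (hΦ : IsFactorRelation Φ) (hor : ∀ᵐ ω ∂(edgeLabelLaw G), G.Orients (Φ ω))
    (hℓ : ∀ᵐ ω ∂(edgeLabelLaw G), Function.Injective (G.vertexLabel ω)) :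
    ∃ Ψ : (G.edgeSet → unitInterval) → V → V → Prop, IsFactorRelation Ψ ∧
      (∀ᵐ ω ∂(edgeLabelLaw G), G.Orients (Ψ ω)) ∧
      ∀ᵐ ω ∂(edgeLabelLaw G), ∀ x, (∃ y, Ψ ω x y) ∧ ((∃ y, Φ ω y x) → ∃ y, Ψ ω y x) := by
  have hstable := ae_all_iff.2 fun x =>
    hG.ae_eventually_not_between_selects hd hreg hΦ hor hℓ x
  have hsink := ae_all_iff.2 fun x => hG.ae_exists_not_sink hd hreg hΦ hor hℓ x
  have key : ∀ {ω}, G.Orients (Φ ω) →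
      (∀ x, ∀ᶠ n in atTop, ∀ v w, G.Selects (sinkRemoval Φ n ω) (G.vertexLabel ω) n v w →
        G.dist w x + G.dist x v ≠ G.dist w v) →
      ∀ x, ∃ N, (∀ n ≥ N, ∀ y, G.Adj x y →
        ((sinkRemoval Φ n ω x y ↔ ∃ K, ∀ k ≥ K, sinkRemoval Φ k ω x y) ∧
        (sinkRemoval Φ n ω y x ↔ ∃ K, ∀ k ≥ K, sinkRemoval Φ k ω y x))) := by
    intro ω hω h x
    obtain ⟨N, hN⟩ := eventually_atTop.1 (h x)
    -- Once no reversed geodesic meets `x`, all edges at `x` are frozen.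
    have const : ∀ y z, (G.Adj y z ∧ (x = y ∨ x = z)) → ∀ n ≥ N,
        (sinkRemoval Φ n ω y z ↔ sinkRemoval Φ N ω y z) := by
      intro y z hyz n hn
      induction n, hn using Nat.le_induction with
      | base => rfl
      | succ n hn ih =>
        rw [← ih]
        refine reverseAlong_of_not_onSome ?_
        rcases hyz.2 with rfl | rfl
        · exact hG.1.not_onSome_of_forall_not_between hyz.1 (hN n hn)
        · exact fun h => hG.1.not_onSome_of_forall_not_between hyz.1.symm (hN n hn)
            (onSome_comm.1 h)
    have lim : ∀ y z, (G.Adj y z ∧ (x = y ∨ x = z)) → ∀ n ≥ N,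
        (sinkRemoval Φ n ω y z ↔ ∃ K, ∀ k ≥ K, sinkRemoval Φ k ω y z) := by
      intro y z hyz n hn
      rw [const y z hyz n hn]
      refine ⟨fun h => ⟨N, fun k hk => (const y z hyz k hk).2 h⟩, fun ⟨K, hK⟩ => ?_⟩
      exact (const y z hyz (max K N) (le_max_right _ _)).1 (hK _ (le_max_left _ _))
    exact ⟨N, fun n hn y hy => ⟨lim x y ⟨hy, .inl rfl⟩ n hn, lim y x ⟨hy.symm, .inr rfl⟩ n hn⟩⟩
  -- Taking eventual truth as the limit defines it at every labelling, so equivariance holds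
  -- everywhere, even where the stages do not converge.
  refine ⟨fun ω x y => ∃ K, ∀ k ≥ K, sinkRemoval Φ k ω x y, ⟨?_, ?_⟩, ?_, ?_⟩
  · exact fun x y => .exists fun K => .forall fun k =>
      measurable_const.imp ((hΦ.sinkRemoval k).measurable x y)
  · intro γ ω x y
    simp only [(hΦ.sinkRemoval _).equivariant]
  · filter_upwards [hor, hstable] with ω hω hst
    constructor
    · rintro x y ⟨K, hK⟩
      exact (orients_sinkRemoval hω K).adj (hK K le_rfl)
    · intro x y hxy
      obtain ⟨N, hN⟩ := key hω hst x
      obtain ⟨h1, h2⟩ := hN N le_rfl y hxy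
      rw [← h1, ← h2]
      exact (orients_sinkRemoval hω N).iff_not hxy
  · filter_upwards [hor, hstable, hsink] with ω hω hst hs x
    obtain ⟨N, hN⟩ := key hω hst x
    constructor
    · obtain ⟨n, hn⟩ := hs x
      have hmono : ∀ m ≥ n, ∃ y, sinkRemoval Φ m ω x y := fun m hm => by
        induction m, hm using Nat.le_induction with
        | base => exact hn
        | succ m _ ih =>
          exact isAugmentingMatching_selects.not_sink (orients_sinkRemoval hω m) hG ih
      obtain ⟨y, hy⟩ := hmono (max n N) (le_max_left _ _)
      exact ⟨y, (hN _ (le_max_right _ _) y ((orients_sinkRemoval hω _).adj hy)).1.1 hy⟩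
    · intro hsrc
      have hmono : ∀ m, ∃ y, sinkRemoval Φ m ω y x := fun m => by
        induction m with
        | zero => exact hsrc
        | succ m ih =>
          exact isAugmentingMatching_selects.not_source (orients_sinkRemoval hω m) hG (hdeg x) ih
      obtain ⟨y, hy⟩ := hmono N
      exact ⟨y, (hN N le_rfl y ((orients_sinkRemoval hω _).adj hy).symm).2.1 hy⟩

omit [G.LocallyFinite] [Countable V] in
theorem Orients.swap {R : V → V → Prop} (h : G.Orients R) : G.Orients fun x y => R y x where
  adj hxy := (h.adj hxy).symm
  iff_not hxy := h.iff_not hxy.symm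

theorem IsTree.exists_factor_sinkless_sourceless (hG : G.IsTree) (hd : 3 ≤ d)
    (hreg : G.IsRegularOfDegree d) :
    ∃ Ψ : (G.edgeSet → unitInterval) → V → V → Prop, IsFactorRelation Ψ ∧
      (∀ᵐ ω ∂(edgeLabelLaw G), G.Orients (Ψ ω)) ∧
      ∀ᵐ ω ∂(edgeLabelLaw G), ∀ x, (∃ y, Ψ ω x y) ∧ ∃ y, Ψ ω y x := by
  classical
  have hdeg : ∀ x y : V, ∃ y', G.Adj x y' ∧ y' ≠ y := by
    intro x y
    have h1 : 1 < (G.neighborFinset x).card := by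
      have : (G.neighborFinset x).card = d := hreg x
      omega
    obtain ⟨y', hy', hne⟩ := Finset.exists_mem_ne h1 y
    exact ⟨y', by simpa using hy', hne⟩
  have hℓ := ae_injective_vertexLabel hdeg
  have hΦ : IsFactorRelation fun (ω : G.edgeSet → unitInterval) x y =>
      G.Adj x y ∧ G.vertexLabel ω x < G.vertexLabel ω y := by
    constructor
    · exact fun x y => measurable_const.and (measurableSet_setOfPred.1
        (measurableSet_lt (measurable_vertexLabel x) (measurable_vertexLabel y)))
    · intro γ ω x y
      rw [vertexLabel_actLabelling, vertexLabel_actLabelling, γ.map_adj_iff]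
  have hor : ∀ᵐ ω ∂(edgeLabelLaw G), G.Orients fun x y =>
      G.Adj x y ∧ G.vertexLabel ω x < G.vertexLabel ω y := by
    filter_upwards [hℓ] with ω hω
    refine ⟨fun h => h.1, fun {x y} hxy => ?_⟩
    simp only [hxy, hxy.symm, true_and, not_lt]
    exact ⟨le_of_lt, fun h => lt_of_le_of_ne h fun he => hxy.ne (hω he)⟩
  obtain ⟨Ψ, hΨ, hΨor, hΨs⟩ := hG.exists_factor_sinkless hd hreg hdeg hΦ hor hℓ
  -- `Ψ` has no sinks, so its opposite has no sources; the second pass removes the sinks of the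
  -- opposite and creates no sources.
  obtain ⟨Ξ, hΞ, hΞor, hΞs⟩ := hG.exists_factor_sinkless hd hreg hdeg hΨ.swap
    (hΨor.mono fun ω hω => hω.swap) hℓ
  refine ⟨Ξ, hΞ, hΞor, ?_⟩
  filter_upwards [hΨs, hΞs] with ω h1 h2 x
  exact ⟨(h2 x).1, (h2 x).2 (h1 x).1⟩

end SimpleGraph

/-! ### From relations to markings of darts -/

theorem theorem5 (d : ℕ) (hd : 3 ≤ d) {V : Type*} (G : SimpleGraph V) [G.LocallyFinite]
    (hG : G.IsTree) (hreg : G.IsRegularOfDegree d) :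
    ∃ F : (G.edgeSet → unitInterval) → (G.Dart → Bool),
      IsFIIDOrientation G F ∧
        ∀ᵐ ω ∂(edgeLabelLaw G), ∀ v : V, ¬ IsSource (F ω) v ∧ ¬ IsSink (F ω) v := by
  classical
  have := hG.1.countable
  obtain ⟨Ψ, hΨ, hor, hs⟩ := hG.exists_factor_sinkless_sourceless hd hreg
  refine ⟨fun ω a => decide (Ψ ω a.fst a.snd), ⟨?_, ?_, ?_⟩, ?_⟩
  · refine measurable_pi_lambda _ fun a => ?_
    exact (measurable_of_countable fun p : Prop => decide p).comp (hΨ.measurable a.fst a.snd)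
  · intro γ ω
    funext a
    have := hΨ.equivariant γ ω (γ.symm a.fst) (γ.symm a.snd)
    rw [γ.apply_symm_apply, γ.apply_symm_apply] at this
    exact decide_eq_decide.2 this
  · filter_upwards [hor] with ω hω a
    change decide (Ψ ω a.snd a.fst) = !decide (Ψ ω a.fst a.snd)
    rw [← decide_not]
    exact decide_eq_decide.2 (hω.iff_not a.adj.symm)
  · filter_upwards [hor, hs] with ω hω hsω v
    obtain ⟨⟨y, hy⟩, z, hz⟩ := hsω v
    constructor
    · intro h
      have := h ⟨(v, z), (hω.adj hz).symm⟩ rfl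
      exact hω.asymm hz (of_decide_eq_true this)
    · intro h
      have := h ⟨(y, v), (hω.adj hy).symm⟩ rfl
      exact hω.asymm hy (of_decide_eq_true this)
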